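/- Let $n\ge 2$ and let $\Gamma_1=(V_1,E_1),\dots,\Gamma_n=(V_n,E_n)$ be connected, vertex-transitive simple graphs (possibly infinite, not necessarily locally finite), each with at least two vertices. Choose $(u_1,\dots,u_n)\in V_1\times\dots\times V_n$, and let $\Gamma$ be the free product of $\Gamma_1,\dots,\Gamma_n$ initialised at $(u_1,\dots,u_n)$, defined as follows. Vertices. The vertices of $\Gamma$ are the admissible words in the alphabet $V_1\sqcup\dots\sqcup V_n$, defined together with maps $u_i$ (for $1\le i\le n$) from admissible words to $V_i$. The empty word $\emptyset$ is admissible, with $u_i(\emptyset)=u_i$. If $v$ is an admissible word and $x\in V_j$, then $vx$ is admissible if and only if $v$ is empty or its last letter is not in $V_j$, and $x\neq u_j(v)$; in this case $u_j(vx)=x$ and $u_h(vx)=u_h(v)$ for $h\neq j$. Edges. The edges of $\Gamma$ are the pairs $\{v,vx\}$ of admissible words with $x\in V_j$ and $\{u_j(v),x\}\in E_j$ for some $j$, and the pairs $\{vx,vy\}$ of admissible words with $x,y\in V_j$ and $\{x,y\}\in E_j$ for some $j$. Sheets. For a vertex $v$ of $\Gamma$ and $j\in\{1,\dots,n\}$,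 let $b$ be the word $v$ with its last letter removed if that letter belongs to $V_j$, and let $b=v$ otherwise. The $\Gamma_j$-sheet $S_{(v,j)}$ at $v$ is the subgraph of $\Gamma$ spanned by $\{b\}\cup\{bx\mid x\in V_j,\ x\neq u_j(b)\}$. Put $\mathcal S=\{S_{(v,j)}\mid v\in V(\Gamma),\ 1\le j\le n\}$. Let $\mathrm{Aut}_{\mathcal S}(\Gamma)$ be the group of all $\alpha\in\mathrm{Aut}(\Gamma)$ such that $\alpha(S)\in\mathcal S$ for every $S\in\mathcal S$, and let $\mathrm{Aut}_{\mathcal S}(\Gamma)^{+_{\mathcal S}}$ be its subgroup generated by the stabilisers $\{\alpha\in\mathrm{Aut}_{\mathcal S}(\Gamma)\mid \alpha(v)=v,\ \alpha(S)=S\}$ for all $S\in\mathcal S$ and all vertices $v$ of $S$. Then the group $\mathrm{Aut}_{\mathcal S}(\Gamma)^{+_{\mathcal S}}$ is either trivial or simple. -/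

import Mathlib

namespace GraphFreeProduct

universe w

variable {n : ℕ} {V : Fin n → Type w}

/-- A graph is vertex-transitive if its automorphism group acts transitively on its vertices. -/
def IsVertexTransitive {X : Type*} (G : SimpleGraph X) : Prop :=
  ∀ x y : X, ∃ α : G ≃g G, α x = y

/-- Finite words in the disjoint union of the vertex sets `V 0, …, V (n-1)`.
Words are stored with the *last* letter first: the list `[v_l, …, v_1]` is the word `v_1 … v_l`,
so that `⟨j, x⟩ :: v` is the word `v` with the letter `x ∈ V j` appended, and `[]` is the empty
word. -/
abbrev Word (V : Fin n → Type w) : Type w := List (Σ i, V i)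

/-- The update function: `update u [] = u`, and appending a letter `x ∈ V j` replaces the `j`-th
component by `x`. -/
def update (u : ∀ i, V i) : Word V → ∀ i, V i
  | [] => u
  | ⟨j, x⟩ :: v => Function.update (update u v) j x

/-- The word `v` is non-empty and its last letter belongs to `V j`. -/
def EndsIn (j : Fin n) : Word V → Prop
  | [] => False
  | ⟨i, _⟩ :: _ => i = j

/-- Admissible words: the empty word is admissible, and `v x` with `x ∈ V j` is admissible iff
`v` is admissible, does not end with a letter of `V j`, and `x ≠ u_j(v)`. -/
def Admissible (u : ∀ i, V i) : Word V → Prop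
  | [] => True
  | ⟨j, x⟩ :: v => Admissible u v ∧ ¬ EndsIn j v ∧ x ≠ update u v j

/-- The vertices of the free product: the admissible words. -/
abbrev Vertex (u : ∀ i, V i) : Type w := {v : Word V // Admissible u v}

/-- The edge relation of the free product, as a relation on words. -/
inductive WordAdj (Γ : ∀ i, SimpleGraph (V i)) (u : ∀ i, V i) : Word V → Word V → Prop
  /-- an edge `{v, v x}` whenever `{u_j(v), x}` is an edge of `Γ j` -/
  | append (v : Word V) (j : Fin n) (x : V j) (h : (Γ j).Adj (update u v j) x) :
      WordAdj Γ u v (⟨j, x⟩ :: v)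
  /-- the same edge, with its end points in the other order -/
  | remove (v : Word V) (j : Fin n) (x : V j) (h : (Γ j).Adj (update u v j) x) :
      WordAdj Γ u (⟨j, x⟩ :: v) v
  /-- an edge `{v x, v y}` whenever `{x, y}` is an edge of `Γ j` -/
  | replace (v : Word V) (j : Fin n) (x y : V j) (h : (Γ j).Adj x y) :
      WordAdj Γ u (⟨j, x⟩ :: v) (⟨j, y⟩ :: v)

/-- The free product of the graphs `Γ 0, …, Γ (n-1)`, initialised with `u`. -/
def freeProduct (Γ : ∀ i, SimpleGraph (V i)) (u : ∀ i, V i) : SimpleGraph (Vertex u) where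
  Adj v v' := WordAdj Γ u v.1 v'.1
  symm := ⟨by
    rintro ⟨v, _⟩ ⟨v', _⟩ h
    cases h with
    | append _ j x h => exact .remove _ j x h
    | remove _ j x h => exact .append _ j x h
    | replace _ j x y h => exact .replace _ j y x h.symm⟩
  loopless := ⟨by
    rintro ⟨v, _⟩ h
    have key : ∀ a b : Word V, WordAdj Γ u a b → a ≠ b := by
      intro a b h
      cases h with
      | append _ j x h => simp
      | remove _ j x h => simp
      | replace _ j x y h => simpa using h.ne
    exact key v v h rfl⟩

open Classical in
/-- `v` with its last letter removed if that letter belongs to `V j`, and `v` itself otherwise. -/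
noncomputable def sheetBase (j : Fin n) (v : Word V) : Word V :=
  if EndsIn j v then v.tail else v

/-- The (vertex set of the) `Γ j`-sheet at `v`: the admissible words that are equal to
`b := sheetBase j v` or to `b x` for some `x ∈ V j`. The sheet is the subgraph spanned by this
set, so it is recorded by its vertex set; admissibility of `b x` means `x ≠ u_j(b)`. -/
def sheet {u : ∀ i, V i} (v : Vertex u) (j : Fin n) : Set (Vertex u) :=
  {z | z.1 = sheetBase j v.1 ∨ ∃ x : V j, z.1 = ⟨j, x⟩ :: sheetBase j v.1}

/-- The set of all sheets of the free product. -/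
def sheets (u : ∀ i, V i) : Set (Set (Vertex u)) :=
  {S | ∃ (v : Vertex u) (j : Fin n), S = sheet v j}

/-- The group of automorphisms of the free product. -/
abbrev Aut (Γ : ∀ i, SimpleGraph (V i)) (u : ∀ i, V i) : Type w :=
  freeProduct Γ u ≃g freeProduct Γ u

/-- `α` maps every sheet to a sheet. -/
def MapsSheets {Γ : ∀ i, SimpleGraph (V i)} {u : ∀ i, V i} (α : Aut Γ u) : Prop :=
  ∀ S ∈ sheets u, (fun z => α z) '' S ∈ sheets u

/-- The group of sheet-preserving automorphisms. For connected factors with at least two vertices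
the condition on `α⁻¹` is automatic, see `mem_autS_iff`. -/
def autS (Γ : ∀ i, SimpleGraph (V i)) (u : ∀ i, V i) : Subgroup (Aut Γ u) where
  carrier := {α | MapsSheets α ∧ MapsSheets α⁻¹}
  one_mem' := by
    have h : MapsSheets (1 : Aut Γ u) := by
      intro S hS
      have : (fun z => (1 : Aut Γ u) z) '' S = S := by
        simp [RelIso.coe_one]
      rwa [this]
    exact ⟨h, by simpa using h⟩
  mul_mem' := by
    have h : ∀ α β : Aut Γ u, MapsSheets α → MapsSheets β → MapsSheets (α * β) := by
      intro α β hα hβ S hS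
      have := hα _ (hβ S hS)
      rw [Set.image_image] at this
      exact this
    rintro α β ⟨hα, hα'⟩ ⟨hβ, hβ'⟩
    exact ⟨h α β hα hβ, by rw [mul_inv_rev]; exact h _ _ hβ' hα'⟩
  inv_mem' := by
    rintro α ⟨h, h'⟩
    exact ⟨h', by simpa using h⟩

/-- For `H` a subgroup, a sheet `S` and a vertex `v`: the elements of `H` that fix `v` and leave
`S` invariant. -/
def flagStabilizer {Γ : ∀ i, SimpleGraph (V i)} {u : ∀ i, V i} (H : Subgroup (Aut Γ u))
    (S : Set (Vertex u)) (v : Vertex u) : Set (Aut Γ u) :=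
  {h | h ∈ H ∧ h v = v ∧ (fun z => h z) '' S = S}

/-- The subgroup generated by the stabilisers in `H` of all pairs `(S, v)` consisting of a sheet
`S` and a vertex `v` of `S`. -/
def plusS {Γ : ∀ i, SimpleGraph (V i)} {u : ∀ i, V i} (H : Subgroup (Aut Γ u)) :
    Subgroup (Aut Γ u) :=
  Subgroup.closure (⋃ S ∈ sheets u, ⋃ v ∈ S, flagStabilizer H S v)

theorem not_endsIn_sheetBase {u : ∀ i, V i} (v : Vertex u) (j : Fin n) :
    ¬ EndsIn j (sheetBase j v.1) := by
  obtain ⟨v, hv⟩ := v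
  by_cases h : EndsIn j v
  · cases v with
    | nil => exact h.elim
    | cons a t =>
      obtain ⟨i, x⟩ := a
      have hij : i = j := h
      subst hij
      simpa [sheetBase, h] using hv.2.1
  · simp [sheetBase, h]

theorem admissible_sheetBase {u : ∀ i, V i} (v : Vertex u) (j : Fin n) :
    Admissible u (sheetBase j v.1) := by
  obtain ⟨v, hv⟩ := v
  by_cases h : EndsIn j v
  · cases v with
    | nil => exact h.elim
    | cons a t =>
      obtain ⟨i, x⟩ := a
      simpa [sheetBase, h] using hv.1
  · simpa [sheetBase, h] using hv

/-- Two sheets with two common vertices are equal. -/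
theorem sheet_unique {u : ∀ i, V i} {S T : Set (Vertex u)} (hS : S ∈ sheets u)
    (hT : T ∈ sheets u) {p q : Vertex u} (hpq : p ≠ q) (hpS : p ∈ S) (hqS : q ∈ S)
    (hpT : p ∈ T) (hqT : q ∈ T) : S = T := by
  obtain ⟨v, i, rfl⟩ := hS
  obtain ⟨w, j, rfl⟩ := hT
  have hpq' : p.1 ≠ q.1 := fun h => hpq (Subtype.ext h)
  suffices h : i = j ∧ sheetBase i v.1 = sheetBase j w.1 by
    obtain ⟨rfl, h⟩ := h
    simp only [sheet, h]
  simp only [sheet, Set.mem_ofPred_eq] at hpS hqS hpT hqT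
  generalize sheetBase i v.1 = a at *
  generalize sheetBase j w.1 = b at *
  rcases hpS with h1 | ⟨x, h1⟩ <;> rcases hqS with h2 | ⟨y, h2⟩ <;>
    rcases hpT with h3 | ⟨z, h3⟩ <;> rcases hqT with h4 | ⟨t, h4⟩ <;>
    rw [h1] at h3 hpq' <;> rw [h2] at h4 hpq'
  all_goals first
    | exact absurd rfl hpq'
    | (have l1 := congrArg List.length h3
       have l2 := congrArg List.length h4
       simp at l1 l2
       omega)
    | simp_all

theorem exists_sheet_of_adj {Γ : ∀ i, SimpleGraph (V i)} {u : ∀ i, V i} {p q : Vertex u}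
    (h : (freeProduct Γ u).Adj p q) : ∃ S ∈ sheets u, p ∈ S ∧ q ∈ S := by
  obtain ⟨p, hp⟩ := p
  obtain ⟨q, hq⟩ := q
  have h' : WordAdj Γ u p q := h
  cases h' with
  | append _ j x h =>
    refine ⟨sheet ⟨p, hp⟩ j, ⟨_, _, rfl⟩, ?_⟩
    simp [sheet, sheetBase, hq.2.1]
  | remove _ j x h =>
    refine ⟨sheet ⟨q, hq⟩ j, ⟨_, _, rfl⟩, ?_⟩
    simp [sheet, sheetBase, hp.2.1]
  | replace v j x y h =>
    refine ⟨sheet ⟨v, hp.1⟩ j, ⟨_, _, rfl⟩, ?_⟩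
    simp [sheet, sheetBase, hp.2.1]

theorem exists_adj_of_sheet {Γ : ∀ i, SimpleGraph (V i)} {u : ∀ i, V i}
    (hconn : ∀ i, (Γ i).Connected) (hnt : ∀ i, Nontrivial (V i)) {S : Set (Vertex u)}
    (hS : S ∈ sheets u) : ∃ p ∈ S, ∃ q ∈ S, (freeProduct Γ u).Adj p q := by
  obtain ⟨v, j, rfl⟩ := hS
  have := hnt j
  obtain ⟨x, hx⟩ := (hconn j).preconnected.exists_adj_of_nontrivial (update u (sheetBase j v.1) j)
  refine ⟨⟨_, admissible_sheetBase v j⟩, Or.inl rfl,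
    ⟨⟨j, x⟩ :: sheetBase j v.1, admissible_sheetBase v j, not_endsIn_sheetBase v j, hx.ne'⟩,
    Or.inr ⟨x, rfl⟩, .append _ j x hx⟩

/-- For connected factors with at least two vertices, an automorphism belongs to `autS` iff it maps
every sheet to a sheet. -/
theorem mem_autS_iff {Γ : ∀ i, SimpleGraph (V i)} {u : ∀ i, V i}
    (hconn : ∀ i, (Γ i).Connected) (hnt : ∀ i, Nontrivial (V i)) (α : Aut Γ u) :
    α ∈ autS Γ u ↔ ∀ S ∈ sheets u, (fun z => α z) '' S ∈ sheets u := by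
  refine ⟨fun h => h.1, fun h => ⟨h, fun T hT => ?_⟩⟩
  obtain ⟨p, hp, q, hq, hpq⟩ := exists_adj_of_sheet hconn hnt hT
  have hpq' : (freeProduct Γ u).Adj (α⁻¹ p) (α⁻¹ q) := (α⁻¹).map_rel_iff.2 hpq
  obtain ⟨S, hS, hpS, hqS⟩ := exists_sheet_of_adj hpq'
  have e : (fun z => α z) '' S = T :=
    sheet_unique (h S hS) hT hpq.ne ⟨_, hpS, RelIso.apply_inv_self α p⟩
      ⟨_, hqS, RelIso.apply_inv_self α q⟩ hp hq
  have : (fun z => α⁻¹ z) '' T = S := by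
    rw [← e, Set.image_image]
    simp
  rwa [this]

end GraphFreeProduct

/-!
The sheets and the vertices of the free product form a bipartite tree on which the group
`G = autS Γ u` acts, and `plusS G` is generated by the stabilisers of the edges of this tree. The theorem is an
instance of Tits' simplicity criterion for groups acting on trees with the independence property.
The tree itself is not constructed; its half-trees are used instead.

**Criterion.** `HalfSpace.IsSystem` lists the properties of a `G`-invariant family of half-spaces of
a set on which `G` acts: any two are nested, finitely many separate two given points, `G` moves any
half-space into any other one, and elements supported in pairwise disjoint half-spaces can be glued.
Let `P` be generated by the elements of `G` supported in half-spaces, and let `N ≠ 1` be a subgroup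
of `P` normalised by `P`. Since an element with a fixed point cannot act as a translation
(`exists_displaced_of_mem_rist`), a nontrivial element supported in a half-space `Y` moves some
half-space inside `Y` off itself; so half-spaces branch, and `P` moves any half-space off itself and
into any other one (`displaces_plus`, `exists_smul_subset_of_displaces`). By branching, `N` moves
some half-space off itself (`exists_displaced`), hence, being normalised by `P`, all of them. So for
any half-space `Y` there is a translation `t ∈ N` for which the `t ^ k • Y`, `k ≥ 0`, are pairwise
disjoint and contained in a single half-space (`exists_disjoint_pow_smul`). If `g ∈ G` is supported
in `Y`, the conjugates of `g` by the `t ^ k` glue to an element `F ∈ P`, and `g` is the commutator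
of `F` and `t` (`rist_le_of_displaces`). Thus `P ≤ N`.

**Half-spaces of the free product.** For a vertex `v` of a sheet `S`, the branch at `v` through `S`
consists of the vertices reached from `S` without passing through `v`. The branches and their
complements are the half-spaces. An edge leaving a branch ends at `v`, so that `S` is the only sheet
meeting both a branch and its complement (`eq_of_crossing`); nestedness and finiteness of separation
follow formally. The structure of words is only needed for the disjointness of different branches at
a vertex (`eq_of_mem_branch`): by transitivity the vertex is the empty word, where branches are told
apart by the first letter. Transitivity (`exists_autType_root`) holds because automorphisms of the
factors can be applied letter by letter, following the resulting moves from a new starting vertex.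
Gluing is possible because being a sheet-preserving automorphism is a condition on single sheets
(`exists_autS_of_local`). It also splits the stabiliser of a flag `(v, S)` into the elements
supported in the branch and those supported in its complement, so that `P = plusS G`
(`plusS_eq_plus`).
-/

/-! ### Tits' simplicity criterion for half-space systems -/

open scoped Pointwise

namespace HalfSpace

variable {A X : Type*} [Group A] [MulAction A X]

/-- A `G`-invariant system `𝓗` of half-spaces of `X`, modelled on the half-trees of a tree on which
`G` acts. The field `glue` is the countable form of Tits' independence property: elements of `G`
supported in pairwise disjoint half-spaces can be performed simultaneously. -/
structure IsSystem (G : Subgroup A) (𝓗 : Set (Set X)) : Prop where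
  compl_mem : ∀ {H}, H ∈ 𝓗 → Hᶜ ∈ 𝓗
  nonempty : ∀ {H}, H ∈ 𝓗 → H.Nonempty
  smul_mem : ∀ {g H}, g ∈ G → H ∈ 𝓗 → g • H ∈ 𝓗
  nested : ∀ {H K}, H ∈ 𝓗 → K ∈ 𝓗 → H ⊆ K ∨ H ⊆ Kᶜ ∨ Hᶜ ⊆ K ∨ Hᶜ ⊆ Kᶜ
  finite_separating : ∀ p q : X, {H | H ∈ 𝓗 ∧ p ∈ H ∧ q ∉ H}.Finite
  exists_separating : ∀ {p q : X}, p ≠ q → ∃ H ∈ 𝓗, p ∈ H ∧ q ∉ H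
  exists_smul_subset : ∀ {H K}, H ∈ 𝓗 → K ∈ 𝓗 → ∃ g ∈ G, g • H ⊆ K
  glue : ∀ (H : ℕ → Set X) (f : ℕ → A), (∀ k, H k ∈ 𝓗) →
    Pairwise (fun k l => Disjoint (H k) (H l)) → (∀ k, f k ∈ G ∧ ∀ z ∉ H k, f k • z = z) →
    ∃ F ∈ G, (∀ k, ∀ z ∈ H k, F • z = f k • z) ∧ ∀ z, (∀ k, z ∉ H k) → F • z = z

/-- The rigid stabiliser of `H`: the elements of `G` that fix every point outside `H`. -/
def rist (G : Subgroup A) (H : Set X) : Subgroup A := G ⊓ fixingSubgroup A Hᶜ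

/-- The subgroup generated by the rigid stabilisers of all half-spaces. -/
def plus (G : Subgroup A) (𝓗 : Set (Set X)) : Subgroup A := ⨆ H ∈ 𝓗, rist G H

/-- `M` contains, for every half-space `Q`, an element that moves `Q` off itself. -/
def Displaces (M : Subgroup A) (𝓗 : Set (Set X)) : Prop :=
  ∀ Q ∈ 𝓗, ∃ f ∈ M, Disjoint Q (f • Q)

theorem mem_rist {G : Subgroup A} {H : Set X} {g : A} :
    g ∈ rist G H ↔ g ∈ G ∧ ∀ z ∉ H, g • z = z := by
  simp [rist, Subgroup.mem_inf, mem_fixingSubgroup_iff]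

theorem rist_mono (G : Subgroup A) {H K : Set X} (h : H ⊆ K) : rist G H ≤ rist G K := fun g hg => by
  rw [mem_rist] at *
  exact ⟨hg.1, fun z hz => hg.2 z fun h' => hz (h h')⟩

theorem conj_mem_rist {G : Subgroup A} {H : Set X} {g f : A} (hg : g ∈ G) (hf : f ∈ rist G H) :
    g * f * g⁻¹ ∈ rist G (g • H) := by
  rw [mem_rist] at *
  refine ⟨G.mul_mem (G.mul_mem hg hf.1) (G.inv_mem hg), fun z hz => ?_⟩
  rw [Set.mem_smul_set_iff_inv_smul_mem] at hz
  rw [mul_smul, mul_smul, hf.2 _ hz, smul_inv_smul]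

theorem smul_eq_of_mem_rist {G : Subgroup A} {H : Set X} {f : A} (hf : f ∈ rist G H) :
    f • H = H := by
  have key : ∀ g ∈ rist G H, ∀ z ∈ H, g • z ∈ H := by
    intro g hg z hz
    by_contra h
    have := (mem_rist.1 hg).2 _ h
    exact h (by rwa [smul_left_cancel g this])
  ext z
  rw [Set.mem_smul_set_iff_inv_smul_mem]
  refine ⟨fun h => ?_, key _ (inv_mem hf) z⟩
  simpa using key f hf _ h

theorem rist_le_plus (G : Subgroup A) {𝓗 : Set (Set X)} {H : Set X} (hH : H ∈ 𝓗) :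
    rist G H ≤ plus G 𝓗 := le_iSup₂_of_le H hH le_rfl

theorem plus_le (G : Subgroup A) (𝓗 : Set (Set X)) : plus G 𝓗 ≤ G :=
  iSup₂_le fun _ _ => inf_le_left

theorem inv_smul_ssubset {a : A} {H : Set X} (h : H ⊂ a • H) : a⁻¹ • H ⊂ H := by
  constructor
  · rw [Set.smul_set_subset_iff_subset_inv_smul_set, inv_inv]; exact h.1
  · intro h2
    exact h.2 (by rwa [Set.smul_set_subset_iff_subset_inv_smul_set])

theorem exists_smul_ne [FaithfulSMul A X] {a : A} (ha : a ≠ 1) : ∃ p : X, a • p ≠ p := by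
  by_contra! h
  exact ha (FaithfulSMul.eq_of_smul_eq_smul fun z : X => by simp [h z])

/-- If an element of `N` displaces one half-space, then its conjugates by `M` displace all
half-spaces, provided that `M` normalises `N` and moves any half-space into any other one. -/
theorem displaces_of_exists {𝓗 : Set (Set X)} {M N : Subgroup A}
    (hMN : ∀ g ∈ M, ∀ x ∈ N, g * x * g⁻¹ ∈ N)
    (hM : ∀ H ∈ 𝓗, ∀ K ∈ 𝓗, ∃ g ∈ M, g • H ⊆ K) {x : A} (hx : x ∈ N) {Z : Set X} (hZ : Z ∈ 𝓗)
    (hd : Disjoint Z (x • Z)) : Displaces N 𝓗 := by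
  intro Q hQ
  obtain ⟨g, hg, hgQ⟩ := hM Q hQ Z hZ
  refine ⟨g⁻¹ * x * g, by simpa using hMN g⁻¹ (M.inv_mem hg) x hx, ?_⟩
  rw [← Set.disjoint_smul_set (a := g), mul_assoc, mul_smul, smul_inv_smul, mul_smul]
  exact hd.mono hgQ (Set.smul_set_mono hgQ)

namespace IsSystem

variable {G : Subgroup A} {𝓗 : Set (Set X)} (hs : IsSystem G 𝓗)
include hs

theorem conj_mem_plus {g f : A} (hg : g ∈ G) (hf : f ∈ plus G 𝓗) : g * f * g⁻¹ ∈ plus G 𝓗 := by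
  have : plus G 𝓗 ≤ (plus G 𝓗).comap (MulAut.conj g).toMonoidHom :=
    iSup₂_le fun H hH f hf => rist_le_plus G (hs.smul_mem hg hH) (conj_mem_rist hg hf)
  exact this hf

/-- The images of a half-space under the powers of an element that maps it properly into itself
leave every point. -/
theorem exists_notMem_pow_smul {a : A} (ha : a ∈ G) {H : Set X} (hH : H ∈ 𝓗) (h : a • H ⊂ H)
    (p : X) : ∃ k : ℕ, p ∉ a ^ k • H := by
  by_contra! hp
  have hanti : StrictAnti fun k : ℕ => a ^ k • H := by
    refine strictAnti_nat_of_succ_lt fun k => ?_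
    rw [pow_succ, mul_smul]
    exact ⟨Set.smul_set_subset_smul_set_iff.2 h.1, fun h' =>
      h.2 (Set.smul_set_subset_smul_set_iff.1 h')⟩
  obtain ⟨q, hq⟩ := hs.nonempty (hs.compl_mem hH)
  refine Set.infinite_of_injective_forall_mem hanti.injective (fun k => ?_)
    (hs.finite_separating p q)
  refine ⟨hs.smul_mem (G.pow_mem ha k) hH, hp k, fun h' => hq ?_⟩
  have := hanti.antitone (Nat.zero_le k) h'
  simpa using this

/-- An element moving `p` either displaces a half-space or acts as a translation whose axis leaves a
half-space containing `p`. -/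
theorem displaces_or_translates {a : A} (ha : a ∈ G) {p : X} (hp : a • p ≠ p) :
    (∃ Z ∈ 𝓗, Disjoint Z (a • Z)) ∨ ∃ H ∈ 𝓗, p ∈ H ∧ a • p ∉ H ∧ H ⊂ a • H := by
  obtain ⟨H, hH, hpH, hpH'⟩ := hs.exists_separating hp.symm
  have hap : a • p ∈ a • H := Set.smul_mem_smul_set hpH
  rcases hs.nested hH (hs.smul_mem ha hH) with h | h | h | h
  · exact Or.inr ⟨H, hH, hpH, hpH', h, fun h' => hpH' (h' hap)⟩
  · exact Or.inl ⟨H, hH, Set.subset_compl_iff_disjoint_right.1 h⟩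
  · refine Or.inl ⟨Hᶜ, hs.compl_mem hH, ?_⟩
    rw [Set.smul_set_compl]
    exact Set.disjoint_compl_right_iff_subset.2 h
  · exact absurd hap (h hpH')

theorem exists_displaced_of_mem_rist [FaithfulSMul A X] {Y : Set X} (hY : Y ∈ 𝓗) {f : A}
    (hf : f ∈ rist G Y) (hf1 : f ≠ 1) : ∃ Z ∈ 𝓗, Z ⊆ Y ∧ Disjoint Z (f • Z) := by
  obtain ⟨hfG, hfix⟩ := mem_rist.1 hf
  obtain ⟨p, hp⟩ := exists_smul_ne (X := X) hf1
  rcases hs.displaces_or_translates hfG hp with ⟨Z, hZ, hd⟩ | ⟨H, hH, -, -, h⟩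
  · refine ⟨Z, hZ, fun z hz => ?_, hd⟩
    by_contra hzY
    exact Set.disjoint_left.1 hd hz ⟨z, hz, hfix z hzY⟩
  · -- a translation has no fixed point, but `f` fixes the points outside `Y`
    exfalso
    obtain ⟨y, hy⟩ := hs.nonempty (hs.compl_mem hY)
    have hfix' : ∀ k : ℕ, f ^ k • y = y := fun k => by
      induction k with
      | zero => simp
      | succ k ih => rw [pow_succ, mul_smul, hfix y hy, ih]
    by_cases hyH : y ∈ H
    · obtain ⟨k, hk⟩ := hs.exists_notMem_pow_smul (G.inv_mem hfG) hH (inv_smul_ssubset h) y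
      rw [Set.mem_smul_set_iff_inv_smul_mem, inv_pow, inv_inv, hfix' k] at hk
      exact hk hyH
    · have h' : f • Hᶜ ⊂ Hᶜ := by
        rw [Set.smul_set_compl]
        exact ⟨Set.compl_subset_compl.2 h.1, fun h2 => h.2 (Set.compl_subset_compl.1 h2)⟩
      obtain ⟨k, hk⟩ := hs.exists_notMem_pow_smul hfG (hs.compl_mem hH) h' y
      refine hk ⟨y, hyH, hfix' k⟩

/-- A group displacing all half-spaces moves any half-space into any other one. -/
theorem exists_smul_subset_of_displaces {M : Subgroup A} (hM : Displaces M 𝓗) {H K : Set X}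
    (hH : H ∈ 𝓗) (hK : K ∈ 𝓗) : ∃ g ∈ M, g • H ⊆ K := by
  obtain ⟨f, hf, hfH⟩ := hM H hH
  obtain ⟨f', hf', hfK⟩ := hM Kᶜ (hs.compl_mem hK)
  have h1 : f • H ⊆ Hᶜ := Set.subset_compl_iff_disjoint_left.2 hfH
  have h2 : f' • Kᶜ ⊆ K := by
    have := Set.subset_compl_iff_disjoint_left.2 hfK
    rwa [compl_compl] at this
  rcases hs.nested hH hK with h | h | h | h
  · exact ⟨1, M.one_mem, by simpa using h⟩
  · exact ⟨f', hf', (Set.smul_set_mono h).trans h2⟩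
  · exact ⟨f, hf, h1.trans h⟩
  · refine ⟨f' * f, M.mul_mem hf' hf, ?_⟩
    rw [mul_smul]
    exact (Set.smul_set_mono (h1.trans h)).trans h2

theorem exists_mem_rist_ne_one (h : plus G 𝓗 ≠ ⊥) {Y : Set X} (hY : Y ∈ 𝓗) :
    ∃ f ∈ rist G Y, f ≠ 1 := by
  obtain ⟨H, hH, f, hf, hf1⟩ : ∃ H ∈ 𝓗, ∃ f ∈ rist G H, f ≠ 1 := by
    by_contra! h'
    exact h (le_bot_iff.1 (iSup₂_le fun H hH f hf => Subgroup.mem_bot.2 (h' H hH f hf)))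
  obtain ⟨g, hg, hgH⟩ := hs.exists_smul_subset hH hY
  exact ⟨g * f * g⁻¹, rist_mono G hgH (conj_mem_rist hg hf), by simpa using hf1⟩

/-- Branching: every half-space contains two disjoint half-spaces. -/
theorem exists_disjoint_pair [FaithfulSMul A X] (h : plus G 𝓗 ≠ ⊥) {Y : Set X} (hY : Y ∈ 𝓗) :
    ∃ f ∈ rist G Y, ∃ Z ∈ 𝓗, Z ⊆ Y ∧ f • Z ∈ 𝓗 ∧ f • Z ⊆ Y ∧ Disjoint Z (f • Z) := by
  obtain ⟨f, hf, hf1⟩ := hs.exists_mem_rist_ne_one h hY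
  obtain ⟨Z, hZ, hZY, hd⟩ := hs.exists_displaced_of_mem_rist hY hf hf1
  refine ⟨f, hf, Z, hZ, hZY, hs.smul_mem (mem_rist.1 hf).1 hZ, ?_, hd⟩
  exact (Set.smul_set_mono hZY).trans (smul_eq_of_mem_rist hf).le

theorem displaces_plus [FaithfulSMul A X] (h : plus G 𝓗 ≠ ⊥) : Displaces (plus G 𝓗) 𝓗 := by
  intro Y hY
  obtain ⟨f, hf, Z, hZ, -, -, -, hd⟩ := hs.exists_disjoint_pair h hY
  exact displaces_of_exists (M := G) (fun g hg x hx => hs.conj_mem_plus hg hx)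
    (fun H hH K hK => hs.exists_smul_subset hH hK) (rist_le_plus G hY hf) hZ hd Y hY

/-- If half-spaces branch, then every nontrivial subgroup `N` of `G` moves some half-space off
itself: a nontrivial element of `N` does so, or else it acts as a translation and one of its powers
does. -/
theorem exists_displaced [FaithfulSMul A X] {N : Subgroup A} (hN : N ≤ G) (hN1 : N ≠ ⊥)
    (h : plus G 𝓗 ≠ ⊥) : ∃ x ∈ N, ∃ Z ∈ 𝓗, Disjoint Z (x • Z) := by
  obtain ⟨x, hx, hx1⟩ := N.ne_bot_iff_exists_ne_one.1 hN1 |> fun ⟨x, hx1⟩ =>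
    (⟨x, x.2, fun e => hx1 (Subtype.ext e)⟩ : ∃ x : A, x ∈ N ∧ x ≠ 1)
  obtain ⟨p, hp⟩ := exists_smul_ne (X := X) hx1
  rcases hs.displaces_or_translates (hN hx) hp with ⟨Z, hZ, hd⟩ | ⟨H, hH, -, -, hxH⟩
  · exact ⟨x, hx, Z, hZ, hd⟩
  -- a high power of the translation `x⁻¹` moves `H` off one of two disjoint half-spaces `T`, `U`
  -- inside `H`, and hence displaces it
  have hxH' := inv_smul_ssubset hxH
  obtain ⟨f, -, T, hT, hTH, hU, hUH, hTU⟩ := hs.exists_disjoint_pair h hH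
  generalize f • T = U at *
  obtain ⟨q, hq⟩ := hs.nonempty hT
  obtain ⟨k, hk⟩ := hs.exists_notMem_pow_smul (G.inv_mem (hN hx)) hH hxH' q
  obtain ⟨r, hr⟩ := hs.nonempty (hs.compl_mem hH)
  have hyN : x⁻¹ ^ k ∈ N := N.pow_mem (N.inv_mem hx) k
  have hyH : x⁻¹ ^ k • H ⊆ H := by
    clear hk
    induction k with
    | zero => simp
    | succ k ih =>
      rw [pow_succ, mul_smul]
      exact (Set.smul_set_mono hxH'.1).trans (ih (N.pow_mem (N.inv_mem hx) k))
  generalize x⁻¹ ^ k = y at *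
  have hyG := hN hyN
  rcases hs.nested (hs.smul_mem hyG hH) hT with h1 | h1 | h1 | h1
  · refine ⟨y, hyN, U, hU, hTU.symm.mono_right ((Set.smul_set_mono hUH).trans h1)⟩
  · refine ⟨y, hyN, T, hT, ?_⟩
    exact Set.subset_compl_iff_disjoint_left.1 ((Set.smul_set_mono hTH).trans h1)
  · exact absurd (hTH (h1 fun h' => hr (hyH h'))) hr
  · exact absurd hq (h1 hk)

/-- In the presence of branching, a displacing group translates along an axis that avoids a given
half-space `Y`. -/
theorem exists_disjoint_pow_smul [FaithfulSMul A X] {N : Subgroup A} (hN : Displaces N 𝓗)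
    (h : plus G 𝓗 ≠ ⊥) {Y : Set X} (hY : Y ∈ 𝓗) :
    ∃ t ∈ N, ∃ W ∈ 𝓗, (∀ k : ℕ, t ^ k • Y ⊆ W) ∧
      Pairwise fun k l : ℕ => Disjoint (t ^ k • Y) (t ^ l • Y) := by
  obtain ⟨f, -, W, hW, hWY, hU, hUY, hd⟩ := hs.exists_disjoint_pair h (hs.compl_mem hY)
  generalize f • W = U at *
  obtain ⟨t, ht, htW⟩ := hs.exists_smul_subset_of_displaces hN (hs.compl_mem hW) hU
  have hUW : U ⊆ Wᶜ := Set.subset_compl_iff_disjoint_left.2 hd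
  have hYW : Y ⊆ Wᶜ := Set.subset_compl_comm.1 hWY
  have hsucc : ∀ k : ℕ, t ^ (k + 1) • Y ⊆ U := by
    intro k
    induction k with
    | zero => simpa using (Set.smul_set_mono hYW).trans htW
    | succ k ih =>
      rw [pow_succ', mul_smul]
      exact (Set.smul_set_mono (ih.trans hUW)).trans htW
  refine ⟨t, ht, Wᶜ, hs.compl_mem hW, fun k => ?_, ?_⟩
  · cases k with
    | zero => simpa using hYW
    | succ k => exact (hsucc k).trans hUW
  · have hlt : ∀ k l : ℕ, k < l → Disjoint (t ^ k • Y) (t ^ l • Y) := by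
      intro k l hkl
      obtain ⟨m, rfl⟩ := Nat.exists_eq_add_of_lt hkl
      rw [add_assoc, pow_add, mul_smul, Set.disjoint_smul_set]
      exact (Set.subset_compl_iff_disjoint_left.1 hUY).mono_right (hsucc m)
    intro k l hkl
    rcases lt_or_gt_of_ne hkl with h | h
    · exact hlt k l h
    · exact (hlt l k h).symm

/-- An element `g` supported in `Y` is the commutator of a translation `t ∈ N` along an axis that
avoids `Y` with the simultaneous product of the conjugates `t ^ k * g * t ^ (-k)`, `k ≥ 0`. -/
theorem rist_le_of_displaces [FaithfulSMul A X] {N : Subgroup A} (hNG : N ≤ G)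
    (hNP : ∀ g ∈ plus G 𝓗, ∀ x ∈ N, g * x * g⁻¹ ∈ N) (hN : Displaces N 𝓗)
    (h : plus G 𝓗 ≠ ⊥) {Y : Set X} (hY : Y ∈ 𝓗) : rist G Y ≤ N := by
  intro g hg
  obtain ⟨t, ht, W, hW, htW, hdisj⟩ := hs.exists_disjoint_pow_smul hN h hY
  have htG : ∀ k : ℕ, t ^ k ∈ G := fun k => G.pow_mem (hNG ht) k
  obtain ⟨F, hF, hF1, hF2⟩ := hs.glue (fun k => t ^ k • Y) (fun k => t ^ k * g * (t ^ k)⁻¹)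
    (fun k => hs.smul_mem (htG k) hY) hdisj
    (fun k => mem_rist.1 (conj_mem_rist (htG k) hg))
  have hFP : F ∈ plus G 𝓗 := by
    refine rist_le_plus G hW (mem_rist.2 ⟨hF, fun z hz => hF2 z fun k hk => hz (htW k hk)⟩)
  have key : g * t * F = F * t := by
    refine FaithfulSMul.eq_of_smul_eq_smul fun z : X => ?_
    simp only [mul_smul]
    by_cases hz : ∃ k : ℕ, z ∈ t ^ k • Y
    · obtain ⟨k, hk⟩ := hz
      have htz : t • z ∈ t ^ (k + 1) • Y := by
        rw [pow_succ', mul_smul]; exact Set.smul_mem_smul_set hk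
      rw [hF1 k z hk, hF1 (k + 1) _ htz]
      have e : (t ^ (k + 1) * g * (t ^ (k + 1))⁻¹) • t • z =
          t • (t ^ k * g * (t ^ k)⁻¹) • z := by
        simp only [← mul_smul]
        congr 1
        group
      rw [e]
      refine (mem_rist.1 hg).2 _ fun h' => ?_
      rw [← e] at h'
      have h2 : (t ^ (k + 1) * g * (t ^ (k + 1))⁻¹) • t • z ∈ t ^ (k + 1) • Y := by
        have := smul_eq_of_mem_rist (conj_mem_rist (htG (k + 1)) hg)
        rw [← this]
        exact Set.smul_mem_smul_set htz
      have h3 := hdisj (show (0 : ℕ) ≠ k + 1 by omega)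
      exact Set.disjoint_left.1 h3 (by simpa using h') h2
    · push Not at hz
      rw [hF2 z hz]
      by_cases hy : t • z ∈ Y
      · have := hF1 0 (t • z) (by simpa using hy)
        simpa using this.symm
      · rw [(mem_rist.1 hg).2 _ hy]
        refine (hF2 _ fun k hk => ?_).symm
        cases k with
        | zero => exact hy (by simpa using hk)
        | succ k =>
          rw [pow_succ', mul_smul, Set.smul_mem_smul_set_iff] at hk
          exact hz k hk
  have e : g = F * t * F⁻¹ * t⁻¹ := by
    rw [← key]; group
  rw [e]
  exact N.mul_mem (hNP F hFP t ht) (N.inv_mem ht)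

/-- Tits' simplicity criterion for half-space systems. -/
theorem plus_le_of_normalized [FaithfulSMul A X] {N : Subgroup A} (hNP : N ≤ plus G 𝓗)
    (hN1 : N ≠ ⊥) (hconj : ∀ g ∈ plus G 𝓗, ∀ x ∈ N, g * x * g⁻¹ ∈ N) : plus G 𝓗 ≤ N := by
  have h : plus G 𝓗 ≠ ⊥ := fun h => hN1 (le_bot_iff.1 (h ▸ hNP))
  have hNG : N ≤ G := hNP.trans (plus_le G 𝓗)
  obtain ⟨x, hx, Z, hZ, hd⟩ := hs.exists_displaced hNG hN1 h
  have hN : Displaces N 𝓗 := displaces_of_exists hconj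
    (fun H hH K hK => hs.exists_smul_subset_of_displaces (hs.displaces_plus h) hH hK) hx hZ hd
  exact iSup₂_le fun H hH => hs.rist_le_of_displaces hNG hconj hN h hH

end IsSystem

end HalfSpace

/-! ### Moves along sheets and transitivity -/

namespace GraphFreeProduct

universe w

section Move

variable {n : ℕ} {V : Fin n → Type w} {u : ∀ i, V i}

theorem sheetBase_of_not_endsIn {j : Fin n} {v : Word V} (h : ¬ EndsIn j v) :
    sheetBase j v = v := by simp [sheetBase, h]

@[simp] theorem sheetBase_cons (j : Fin n) (x : V j) (v : Word V) :
    sheetBase j (⟨j, x⟩ :: v) = v := by simp [sheetBase, EndsIn]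

/-- A vertex is the base of its `j`-sheet, or is obtained from it by appending a letter. -/
theorem eq_sheetBase_or (j : Fin n) (v : Word V) :
    v = sheetBase j v ∨ ∃ x : V j, v = ⟨j, x⟩ :: sheetBase j v := by
  by_cases h : EndsIn j v
  · cases v with
    | nil => exact h.elim
    | cons a t =>
      obtain ⟨i, x⟩ := a
      obtain rfl : i = j := h
      exact Or.inr ⟨x, by simp⟩
  · exact Or.inl (sheetBase_of_not_endsIn h).symm

theorem sheetBase_sheetBase (v : Vertex u) (j : Fin n) :
    sheetBase j (sheetBase j v.1) = sheetBase j v.1 :=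
  sheetBase_of_not_endsIn (not_endsIn_sheetBase v j)

open Classical in
/-- The vertex of the `j`-sheet at `v` whose `j`-th coordinate is `x`. -/
noncomputable def move (v : Vertex u) (j : Fin n) (x : V j) : Vertex u :=
  if h : x = update u (sheetBase j v.1) j then ⟨sheetBase j v.1, admissible_sheetBase v j⟩
  else ⟨⟨j, x⟩ :: sheetBase j v.1, admissible_sheetBase v j, not_endsIn_sheetBase v j, h⟩

theorem sheetBase_move (v : Vertex u) (j : Fin n) (x : V j) :
    sheetBase j (move v j x).1 = sheetBase j v.1 := by
  unfold move
  split
  · exact sheetBase_sheetBase v j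
  · simp

theorem move_congr {v w : Vertex u} {j : Fin n} (h : sheetBase j v.1 = sheetBase j w.1)
    (x : V j) : move v j x = move w j x := by
  apply Subtype.ext
  by_cases hx : x = update u (sheetBase j w.1) j
  · simp [move, h, ← hx]
  · simp [move, h, hx]

@[simp] theorem move_move (v : Vertex u) (j : Fin n) (x y : V j) :
    move (move v j x) j y = move v j y :=
  move_congr (sheetBase_move v j x) y

theorem update_move (v : Vertex u) (j : Fin n) (x : V j) :
    update u (move v j x).1 = Function.update (update u v.1) j x := by
  have h1 : Function.update (update u v.1) j x =
      Function.update (update u (sheetBase j v.1)) j x := by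
    rcases eq_sheetBase_or j v.1 with h | ⟨y, h⟩
    · rw [← h]
    · conv_lhs => rw [h]
      simp [update]
  rw [h1]
  unfold move
  split
  · next h => subst h; simp
  · rfl

@[simp] theorem update_move_same (v : Vertex u) (j : Fin n) (x : V j) :
    update u (move v j x).1 j = x := by simp [update_move]

@[simp] theorem move_update (v : Vertex u) (j : Fin n) : move v j (update u v.1 j) = v := by
  apply Subtype.ext
  unfold move
  rcases eq_sheetBase_or j v.1 with h | ⟨y, h⟩
  · rw [dif_pos (by rw [← h])]
    exact h.symm
  · have hv := v.2
    rw [h] at hv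
    have e : update u v.1 j = y := by
      conv_lhs => rw [h]
      simp [update]
    rw [e, dif_neg hv.2.2]
    exact h.symm

theorem move_eq_cons {v : Vertex u} {j : Fin n} {x : V j} (h : Admissible u (⟨j, x⟩ :: v.1)) :
    move v j x = ⟨⟨j, x⟩ :: v.1, h⟩ := by
  apply Subtype.ext
  unfold move
  have e := sheetBase_of_not_endsIn h.2.1
  rw [dif_neg (by rw [e]; exact h.2.2)]
  simp [e]

/-- Induction on words, phrased through moves. -/
theorem Vertex.move_induction {P : Vertex u → Prop} (nil : P ⟨[], trivial⟩)
    (move : ∀ v j x, P v → P (move v j x)) (v : Vertex u) : P v := by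
  obtain ⟨v, hv⟩ := v
  induction v with
  | nil => exact nil
  | cons a v ih =>
    obtain ⟨j, x⟩ := a
    rw [← move_eq_cons (v := ⟨v, hv.1⟩) hv]
    exact move _ _ _ (ih hv.1)

theorem mem_sheet_iff {v z : Vertex u} {j : Fin n} : z ∈ sheet v j ↔ ∃ x, z = move v j x := by
  constructor
  · intro h
    refine ⟨update u z.1 j, ?_⟩
    have e : sheetBase j z.1 = sheetBase j v.1 := by
      rcases h with h | ⟨x, h⟩
      · rw [h, sheetBase_sheetBase]
      · rw [h, sheetBase_cons]
    conv_lhs => rw [← move_update z j]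
    exact move_congr e _
  · rintro ⟨x, rfl⟩
    unfold move
    split
    · exact Or.inl rfl
    · exact Or.inr ⟨x, rfl⟩

theorem move_mem_sheet (v : Vertex u) (j : Fin n) (x : V j) : move v j x ∈ sheet v j :=
  mem_sheet_iff.2 ⟨x, rfl⟩

theorem self_mem_sheet (v : Vertex u) (j : Fin n) : v ∈ sheet v j :=
  mem_sheet_iff.2 ⟨_, (move_update v j).symm⟩

theorem sheet_eq_of_mem {v z : Vertex u} {j : Fin n} (h : z ∈ sheet v j) :
    sheet z j = sheet v j := by
  obtain ⟨x, rfl⟩ := mem_sheet_iff.1 h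
  ext w
  simp [mem_sheet_iff]

theorem sheet_mem_sheets (v : Vertex u) (j : Fin n) : sheet v j ∈ sheets u := ⟨v, j, rfl⟩

theorem exists_eq_sheet {S : Set (Vertex u)} (hS : S ∈ sheets u) {v : Vertex u} (hv : v ∈ S) :
    ∃ j, S = sheet v j := by
  obtain ⟨w, j, rfl⟩ := hS
  exact ⟨j, (sheet_eq_of_mem hv).symm⟩

theorem move_ne {v : Vertex u} {j : Fin n} {x : V j} (h : x ≠ update u v.1 j) :
    move v j x ≠ v := fun e => h (by rw [← update_move_same v j x, e])

theorem adj_move {Γ : ∀ i, SimpleGraph (V i)} {v : Vertex u} {j : Fin n} {x y : V j}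
    (h : (Γ j).Adj x y) : (freeProduct Γ u).Adj (move v j x) (move v j y) := by
  change WordAdj Γ u _ _
  unfold move
  split <;> split
  · next h1 h2 => exact absurd (h1.trans h2.symm) h.ne
  · next h1 h2 => subst h1; exact .append _ _ _ h
  · next h1 h2 => subst h2; exact .remove _ _ _ h.symm
  · exact .replace _ _ _ _ h

theorem adj_iff_exists_move {Γ : ∀ i, SimpleGraph (V i)} {v z : Vertex u} :
    (freeProduct Γ u).Adj v z ↔
      ∃ j x, (Γ j).Adj (update u v.1 j) x ∧ z = move v j x := by
  constructor
  · intro h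
    obtain ⟨v, hv'⟩ := v
    obtain ⟨z, hz'⟩ := z
    have h' : WordAdj Γ u v z := h
    cases h' with
    | append _ j x hx => exact ⟨j, x, hx, (move_eq_cons (v := ⟨v, hv'⟩) hz').symm⟩
    | remove _ j x hx =>
      refine ⟨j, update u z j, by simpa [update] using hx.symm, ?_⟩
      rw [← move_eq_cons (v := ⟨z, hz'⟩) hv', move_move]
      exact (move_update (⟨z, hz'⟩ : Vertex u) j).symm
    | replace b j x y hx =>
      refine ⟨j, y, by simpa [update] using hx, ?_⟩
      rw [← move_eq_cons (v := ⟨b, hv'.1⟩) hv', move_move, move_eq_cons]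
  · rintro ⟨j, x, h, rfl⟩
    have := adj_move (v := v) h
    rwa [move_update] at this

end Move

section Transitivity

variable {n : ℕ} {V : Fin n → Type w} {Γ : ∀ i, SimpleGraph (V i)} {u : ∀ i, V i}

/-- The empty word. -/
def root (u : ∀ i, V i) : Vertex u := ⟨[], trivial⟩

@[simp] theorem update_root : update u (root u).1 = u := rfl

/-- A map of the free product to itself is `φ`-equivariant if it acts on the `j`-th coordinate of
the vertices of each `j`-sheet through `φ j`. -/
structure IsEquivariant (φ : ∀ i, V i → V i) (α : Vertex u → Vertex u) : Prop where
  update_apply : ∀ v, update u (α v).1 = fun i => φ i (update u v.1 i)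
  apply_move : ∀ v j x, α (move v j x) = move (α v) j (φ j x)

/-- Following the moves that spell a word, relabelled by `φ`, from the starting vertex `p`. -/
noncomputable def follow (p : Vertex u) (φ : ∀ i, V i → V i) : Word V → Vertex u
  | [] => p
  | ⟨j, x⟩ :: v => move (follow p φ v) j (φ j x)

theorem isEquivariant_follow {p : Vertex u} {φ : ∀ i, V i → V i}
    (hp : update u p.1 = fun i => φ i (u i)) :
    IsEquivariant φ (fun v : Vertex u => follow p φ v.1) := by
  have hu : ∀ v : Word V, update u (follow p φ v).1 = fun i => φ i (update u v i) := by
    intro v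
    induction v with
    | nil => exact hp
    | cons a v ih =>
      obtain ⟨j, x⟩ := a
      rw [follow, update_move, ih]
      funext i
      by_cases h : i = j
      · subst h; simp [update]
      · simp [update, h]
  refine ⟨fun v => hu v.1, fun v j x => ?_⟩
  have h1 : ∀ y, move (follow p φ v.1) j y = move (follow p φ (sheetBase j v.1)) j y := by
    intro y
    rcases eq_sheetBase_or j v.1 with h | ⟨t, h⟩
    · rw [← h]
    · conv_lhs => rw [h]
      rw [follow, move_move]
  rw [h1]
  by_cases hx : x = update u (sheetBase j v.1) j
  · have : (move v j x).1 = sheetBase j v.1 := by simp [move, hx]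
    rw [this, hx]
    have := move_update (follow p φ (sheetBase j v.1)) j
    rw [hu] at this
    exact this.symm
  · have : (move v j x).1 = ⟨j, x⟩ :: sheetBase j v.1 := by simp [move, hx]
    rw [this, follow]

theorem IsEquivariant.comp {φ ψ : ∀ i, V i → V i} {α β : Vertex u → Vertex u}
    (hα : IsEquivariant φ α) (hβ : IsEquivariant ψ β) :
    IsEquivariant (fun i => φ i ∘ ψ i) (α ∘ β) :=
  ⟨fun v => by simp [hα.update_apply, hβ.update_apply],
    fun v j x => by simp [hα.apply_move, hβ.apply_move]⟩

theorem IsEquivariant.eq_self {φ : ∀ i, V i → V i} {α : Vertex u → Vertex u}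
    (hα : IsEquivariant φ α) (hφ : ∀ i x, φ i x = x) (h0 : α (root u) = root u) (v : Vertex u) :
    α v = v := by
  induction v using Vertex.move_induction with
  | nil => exact h0
  | move v j x ih => rw [hα.apply_move, ih, hφ]

theorem IsEquivariant.adj {φ : ∀ i, Γ i ≃g Γ i} {α : Vertex u → Vertex u}
    (hα : IsEquivariant (fun i => φ i) α) {v w : Vertex u} (h : (freeProduct Γ u).Adj v w) :
    (freeProduct Γ u).Adj (α v) (α w) := by
  obtain ⟨j, x, hx, rfl⟩ := adj_iff_exists_move.1 h
  refine adj_iff_exists_move.2 ⟨j, φ j x, ?_, hα.apply_move v j x⟩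
  rw [hα.update_apply]
  exact (φ j).map_rel_iff.2 hx

/-- Sheet-preserving automorphisms that preserve the type of every sheet. -/
def autType (Γ : ∀ i, SimpleGraph (V i)) (u : ∀ i, V i) : Set (Aut Γ u) :=
  {g | g ∈ autS Γ u ∧ ∀ v j, (fun z => g z) '' sheet v j = sheet (g v) j}

theorem exists_autType_root_move (htrans : ∀ i, IsVertexTransitive (Γ i)) (j : Fin n) (x : V j) :
    ∃ g ∈ autType Γ u, g (root u) = move (root u) j x := by
  classical
  obtain ⟨α, hα⟩ := htrans j (u j) x
  obtain ⟨φ, hφj, hφ⟩ : ∃ φ : ∀ i, Γ i ≃g Γ i, φ j = α ∧ ∀ i, i ≠ j → φ i = RelIso.refl _ :=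
    ⟨Function.update (fun i => RelIso.refl _) j α, by simp, fun i hi => by simp [hi]⟩
  have hp : update u (move (root u) j x).1 = fun i => φ i (u i) := by
    rw [update_move]
    funext i
    by_cases h : i = j
    · subst h; simp [hφj, hα]
    · simp [h, hφ i h]
  have hq : update u (move (root u) j (α.symm (u j))).1 = fun i => (φ i).symm (u i) := by
    rw [update_move]
    funext i
    by_cases h : i = j
    · subst h; simp [hφj]
    · simp [h, hφ i h]
  have hf := isEquivariant_follow hp
  have hg := isEquivariant_follow hq
  have f0 : follow (move (root u) j x) (fun i => φ i) (root u).1 = move (root u) j x := rfl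
  have g0 : follow (move (root u) j (α.symm (u j))) (fun i => (φ i).symm) (root u).1 =
    move (root u) j (α.symm (u j)) := rfl
  set f : Vertex u → Vertex u := fun v => follow (move (root u) j x) (fun i => φ i) v.1
  set g : Vertex u → Vertex u :=
    fun v => follow (move (root u) j (α.symm (u j))) (fun i => (φ i).symm) v.1
  change f (root u) = _ at f0
  change g (root u) = _ at g0
  have m0 := move_update (root u) j
  rw [update_root] at m0
  have hgf : ∀ v, g (f v) = v := (hg.comp hf).eq_self (by simp) (by
    simp only [Function.comp, f0, hg.apply_move, g0, move_move, hφj]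
    rw [← hα]; simpa using m0)
  have hfg : ∀ v, f (g v) = v := (hf.comp hg).eq_self (by simp) (by
    simp only [Function.comp, g0, hf.apply_move, f0, move_move, hφj]
    simpa using m0)
  let e : Aut Γ u :=
    { toFun := f
      invFun := g
      left_inv := hgf
      right_inv := hfg
      map_rel_iff' := by
        intro a b
        refine ⟨fun h => ?_, hf.adj⟩
        have := hg.adj (φ := fun i => (φ i).symm) h
        simpa [hgf] using this }
  have he : ∀ v i, (fun z => e z) '' sheet v i = sheet (e v) i := by
    intro v i
    ext z
    simp only [Set.mem_image, mem_sheet_iff]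
    constructor
    · rintro ⟨_, ⟨y, rfl⟩, rfl⟩
      exact ⟨_, hf.apply_move v i y⟩
    · rintro ⟨y, rfl⟩
      refine ⟨_, ⟨(φ i).symm y, rfl⟩, ?_⟩
      refine (hf.apply_move v i _).trans ?_
      simp [e]
  refine ⟨e, ⟨⟨?_, ?_⟩, he⟩, rfl⟩
  · rintro _ ⟨v, i, rfl⟩
    exact ⟨_, _, he v i⟩
  · rintro _ ⟨v, i, rfl⟩
    refine ⟨e⁻¹ v, i, ?_⟩
    have := he (e⁻¹ v) i
    rw [RelIso.apply_inv_self] at this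
    rw [← this, Set.image_image]
    simp

/-- Type-preserving automorphisms act transitively on the vertices. -/
theorem exists_autType_root (htrans : ∀ i, IsVertexTransitive (Γ i)) (v : Vertex u) :
    ∃ g ∈ autType Γ u, g (root u) = v := by
  induction v using Vertex.move_induction with
  | nil =>
    refine ⟨1, ⟨Subgroup.one_mem _, fun v j => ?_⟩, rfl⟩
    simp [RelIso.coe_one]
  | move v j x ih =>
    obtain ⟨g, hg, rfl⟩ := ih
    have hm := move_mem_sheet (g (root u)) j x
    rw [← hg.2] at hm
    obtain ⟨z, hz, hz'⟩ := hm
    obtain ⟨y, rfl⟩ := mem_sheet_iff.1 hz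
    obtain ⟨h, hh, hh'⟩ := exists_autType_root_move (u := u) htrans j y
    refine ⟨g * h, ⟨Subgroup.mul_mem _ hg.1 hh.1, fun v i => ?_⟩, ?_⟩
    · rw [RelIso.mul_apply, ← hg.2, ← hh.2, Set.image_image]
      rfl
    · rw [RelIso.mul_apply, hh', ← hz']

end Transitivity

end GraphFreeProduct

/-! ### Branches and half-spaces -/

namespace GraphFreeProduct

universe w

open scoped Pointwise

section Branches

variable {n : ℕ} {V : Fin n → Type w} {Γ : ∀ i, SimpleGraph (V i)} {u : ∀ i, V i}

/-- The standing assumptions on the factors of the free product. -/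
structure IsFactorFamily (Γ : ∀ i, SimpleGraph (V i)) : Prop where
  two_le : 2 ≤ n
  nontrivial : ∀ i, Nontrivial (V i)
  connected : ∀ i, (Γ i).Connected
  transitive : ∀ i, IsVertexTransitive (Γ i)

theorem smul_mem_sheets {g : Aut Γ u} (hg : g ∈ autS Γ u) {S : Set (Vertex u)}
    (hS : S ∈ sheets u) : g • S ∈ sheets u := hg.1 S hS

namespace IsFactorFamily

/-- Sheets are connected: a set that contains one but not every vertex of a sheet is left by an edge
of that sheet. -/
theorem exists_adj_crossing (hΓ : IsFactorFamily Γ) {S : Set (Vertex u)} (hS : S ∈ sheets u)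
    {D : Set (Vertex u)} {p q : Vertex u} (hp : p ∈ S) (hq : q ∈ S) (hpD : p ∈ D) (hqD : q ∉ D) :
    ∃ a ∈ S, ∃ b ∈ S, (freeProduct Γ u).Adj a b ∧ a ∈ D ∧ b ∉ D := by
  obtain ⟨v, j, rfl⟩ := hS
  obtain ⟨x, rfl⟩ := mem_sheet_iff.1 hp
  obtain ⟨y, rfl⟩ := mem_sheet_iff.1 hq
  obtain ⟨W⟩ := (hΓ.connected j).preconnected x y
  obtain ⟨d, -, h1, h2⟩ := W.exists_boundary_dart {x | move v j x ∈ D} hpD hqD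
  exact ⟨_, move_mem_sheet v j d.fst, _, move_mem_sheet v j d.snd, adj_move d.adj, h1, h2⟩

theorem eq_univ_of_adj_closed (hΓ : IsFactorFamily Γ) {D : Set (Vertex u)} (hD : D.Nonempty)
    (h : ∀ a ∈ D, ∀ b, (freeProduct Γ u).Adj a b → b ∈ D) : D = Set.univ := by
  have key : ∀ v, v ∈ D ↔ root u ∈ D := by
    intro v
    induction v using Vertex.move_induction with
    | nil => rfl
    | move v j x ih =>
      rw [← ih]
      have hS : ∀ p ∈ sheet v j, ∀ q ∈ sheet v j, p ∈ D → q ∈ D := by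
        intro p hp q hq hpD
        by_contra hqD
        obtain ⟨a, -, b, -, hab, ha, hb⟩ :=
          hΓ.exists_adj_crossing (sheet_mem_sheets v j) hp hq hpD hqD
        exact hb (h a ha b hab)
      have h1 := move_mem_sheet v j x
      have h2 := self_mem_sheet v j
      exact ⟨hS _ h1 _ h2, hS _ h2 _ h1⟩
  obtain ⟨z, hz⟩ := hD
  exact Set.eq_univ_of_forall fun v => (key v).2 ((key z).1 hz)

theorem exists_mem_sheet_ne (hΓ : IsFactorFamily Γ) {S : Set (Vertex u)} (hS : S ∈ sheets u)
    {v : Vertex u} (hv : v ∈ S) : ∃ w ∈ S, w ≠ v := by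
  obtain ⟨j, rfl⟩ := exists_eq_sheet hS hv
  have := hΓ.nontrivial j
  obtain ⟨x, hx⟩ := exists_ne (update u v.1 j)
  exact ⟨_, move_mem_sheet v j x, move_ne hx⟩

end IsFactorFamily

/-- The branch at `v` through the sheet `S`: the vertices that can be joined to a vertex of `S`
other than `v` by a walk avoiding `v`. -/
def branch (Γ : ∀ i, SimpleGraph (V i)) (v : Vertex u) (S : Set (Vertex u)) : Set (Vertex u) :=
  {z | ∃ w ∈ S, w ≠ v ∧
    Relation.ReflTransGen (fun a b => (freeProduct Γ u).Adj a b ∧ b ≠ v) w z}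

theorem notMem_branch (v : Vertex u) (S : Set (Vertex u)) : v ∉ branch Γ v S := by
  rintro ⟨w, -, hwv, h⟩
  rcases Relation.ReflTransGen.cases_tail h with h | ⟨c, -, h⟩
  · exact hwv h.symm
  · exact h.2 rfl

theorem mem_branch_of_mem {v w : Vertex u} {S : Set (Vertex u)} (hw : w ∈ S) (h : w ≠ v) :
    w ∈ branch Γ v S := ⟨w, hw, h, .refl⟩

theorem ne_of_mem_branch {v w : Vertex u} {S : Set (Vertex u)} (h : w ∈ branch Γ v S) : w ≠ v := by
  rintro rfl
  exact notMem_branch _ _ h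

theorem mem_branch_of_adj {v a b : Vertex u} {S : Set (Vertex u)} (ha : a ∈ branch Γ v S)
    (hab : (freeProduct Γ u).Adj a b) (hb : b ≠ v) : b ∈ branch Γ v S := by
  obtain ⟨w, hw, hwv, h⟩ := ha
  exact ⟨w, hw, hwv, h.tail ⟨hab, hb⟩⟩

/-- Induction principle for branches. -/
theorem branch_subset {v : Vertex u} {S D : Set (Vertex u)} (h0 : ∀ w ∈ S, w ≠ v → w ∈ D)
    (h1 : ∀ a ∈ branch Γ v S, a ∈ D → ∀ b, (freeProduct Γ u).Adj a b → b ≠ v → b ∈ D) :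
    branch Γ v S ⊆ D := by
  rintro z ⟨w, hw, hwv, h⟩
  induction h with
  | refl => exact h0 w hw hwv
  | tail hab hbc ih => exact h1 _ ⟨w, hw, hwv, hab⟩ ih _ hbc.1 hbc.2

theorem smul_branch (g : Aut Γ u) (v : Vertex u) (S : Set (Vertex u)) :
    g • branch Γ v S = branch Γ (g • v) (g • S) := by
  have key : ∀ (g : Aut Γ u) (v : Vertex u) (S : Set (Vertex u)),
      g • branch Γ v S ⊆ branch Γ (g • v) (g • S) := by
    intro g v S
    rw [Set.smul_set_subset_iff_subset_inv_smul_set]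
    refine branch_subset (fun w hw hwv => ?_) fun a _ ha b hab hb => ?_
    · rw [Set.mem_inv_smul_set_iff]
      exact mem_branch_of_mem (Set.smul_mem_smul_set hw) (by simpa using hwv)
    · rw [Set.mem_inv_smul_set_iff] at *
      exact mem_branch_of_adj ha (g.map_rel_iff.2 hab) (by simpa using hb)
  refine (key g v S).antisymm ?_
  have := key g⁻¹ (g • v) (g • S)
  rw [inv_smul_smul, inv_smul_smul] at this
  rwa [Set.smul_set_subset_iff_subset_inv_smul_set, inv_inv] at this

/-- In the branches at the root, the words begin with a letter of the type of the sheet. The first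
letter of a word is the last entry of the list that encodes it. -/
theorem exists_getLast?_of_mem_branch_root {j : Fin n} {z : Vertex u}
    (hz : z ∈ branch Γ (root u) (sheet (root u) j)) : ∃ x, z.1.getLast? = some ⟨j, x⟩ := by
  refine branch_subset (Γ := Γ) (v := root u) (S := sheet (root u) j)
    (D := {z | ∃ x, z.1.getLast? = some ⟨j, x⟩}) (fun w hw hwv => ?_) ?_ hz
  · rcases hw with h | ⟨x, h⟩
    · exact absurd (Subtype.ext (h.trans (sheetBase_of_not_endsIn (v := []) fun h => h))) hwv
    · refine ⟨x, ?_⟩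
      rw [h]
      change (_ :: sheetBase j []).getLast? = _
      rw [sheetBase_of_not_endsIn (v := []) fun h => h]
      rfl
  · have cons : ∀ (a : Σ i, V i) (v : Word V), v ≠ [] → (a :: v).getLast? = v.getLast? := by
      intro a v hv
      cases v with
      | nil => exact absurd rfl hv
      | cons b v => exact List.getLast?_cons_cons
    rintro ⟨a, ha⟩ - ⟨x, hx⟩ ⟨b, hb⟩ hab hb0
    have hab' : WordAdj Γ u a b := hab
    have hb0' : b ≠ [] := fun h => hb0 (Subtype.ext h)
    change ∃ x, b.getLast? = _
    change a.getLast? = _ at hx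
    cases hab' with
    | append _ i y h =>
      refine ⟨x, ?_⟩
      rw [cons _ _ (by rintro rfl; simp at hx), hx]
    | remove _ i y h => exact ⟨x, by rw [← hx, cons _ _ hb0']⟩
    | replace c i y y' h =>
      by_cases hc : c = []
      · subst hc
        simp only [List.getLast?_singleton, Option.some.injEq] at hx
        obtain rfl : i = j := congrArg Sigma.fst hx
        exact ⟨y', rfl⟩
      · exact ⟨x, by rw [cons _ _ hc, ← hx, cons _ _ hc]⟩

namespace IsFactorFamily

variable (hΓ : IsFactorFamily Γ)
include hΓ

theorem exists_autS_smul_sheet (v w : Vertex u) : ∃ g ∈ autS Γ u, g • v = w ∧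
    ∀ j, g • sheet v j = sheet w j := by
  obtain ⟨g, hg, rfl⟩ := exists_autType_root (u := u) hΓ.transitive v
  obtain ⟨h, hh, rfl⟩ := exists_autType_root (u := u) hΓ.transitive w
  refine ⟨h * g⁻¹, Subgroup.mul_mem _ hh.1 (Subgroup.inv_mem _ hg.1), ?_, fun j => ?_⟩
  · rw [mul_smul]
    exact congrArg h (RelIso.inv_apply_self g _)
  · have h1 : g • sheet (root u) j = sheet (g (root u)) j := hg.2 _ j
    have h2 : h • sheet (root u) j = sheet (h (root u)) j := hh.2 _ j
    rw [← h1, ← h2, mul_smul, inv_smul_smul]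

/-- Different branches at the same vertex are disjoint. -/
theorem eq_of_mem_branch {v z : Vertex u} {S T : Set (Vertex u)} (hS : S ∈ sheets u)
    (hT : T ∈ sheets u) (hvS : v ∈ S) (hvT : v ∈ T) (hzS : z ∈ branch Γ v S)
    (hzT : z ∈ branch Γ v T) : S = T := by
  obtain ⟨i, rfl⟩ := exists_eq_sheet hS hvS
  obtain ⟨j, rfl⟩ := exists_eq_sheet hT hvT
  obtain ⟨g, -, hg, hg'⟩ := hΓ.exists_autS_smul_sheet v (root u)
  have key : ∀ k, z ∈ branch Γ v (sheet v k) → ∃ x, (g • z).1.getLast? = some ⟨k, x⟩ := by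
    intro k hk
    have := Set.smul_mem_smul_set (a := g) hk
    rw [smul_branch, hg, hg'] at this
    exact exists_getLast?_of_mem_branch_root this
  obtain ⟨x, hx⟩ := key i hzS
  obtain ⟨y, hy⟩ := key j hzT
  rw [hx, Option.some.injEq] at hy
  obtain rfl : i = j := congrArg Sigma.fst hy
  rfl

theorem exists_mem_branch {v z : Vertex u} (h : z ≠ v) :
    ∃ S ∈ sheets u, v ∈ S ∧ z ∈ branch Γ v S := by
  have := hΓ.eq_univ_of_adj_closed (D := {z | z = v ∨ ∃ S ∈ sheets u, v ∈ S ∧ z ∈ branch Γ v S})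
    ⟨v, Or.inl rfl⟩ ?_
  · exact (Set.eq_univ_iff_forall.1 this z).resolve_left h
  · rintro a ha b hab
    by_cases hb : b = v
    · exact Or.inl hb
    · right
      rcases ha with rfl | ⟨S, hS, hvS, ha⟩
      · obtain ⟨S, hS, haS, hbS⟩ := exists_sheet_of_adj hab
        exact ⟨S, hS, haS, mem_branch_of_mem hbS hb⟩
      · exact ⟨S, hS, hvS, mem_branch_of_adj ha hab hb⟩

/-- The only sheet that meets both a branch and its complement is the one defining the branch. -/
theorem eq_of_crossing {v p q : Vertex u} {S T : Set (Vertex u)} (hS : S ∈ sheets u)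
    (hvS : v ∈ S) (hT : T ∈ sheets u) (hpT : p ∈ T) (hqT : q ∈ T) (hp : p ∈ branch Γ v S)
    (hq : q ∉ branch Γ v S) : T = S := by
  obtain ⟨a, haT, b, hbT, hab, ha, hb⟩ := hΓ.exists_adj_crossing hT hpT hqT hp hq
  obtain rfl : b = v := by
    by_contra hbv
    exact hb (mem_branch_of_adj ha hab hbv)
  exact hΓ.eq_of_mem_branch hT hS hbT hvS (mem_branch_of_mem haT hab.ne) ha

/-- Two branches pointing towards each other cover everything. -/
theorem compl_branch_subset {v w : Vertex u} {S T : Set (Vertex u)} (hT : T ∈ sheets u)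
    (hwT : w ∈ T) (hw : w ∈ branch Γ v S) (hv : v ∈ branch Γ w T) :
    (branch Γ w T)ᶜ ⊆ branch Γ v S := by
  intro z hz
  by_cases hzw : z = w
  · exact hzw ▸ hw
  obtain ⟨R, hR, hwR, hzR⟩ := hΓ.exists_mem_branch hzw
  have hvR : v ∉ branch Γ w R := fun h => hz (hΓ.eq_of_mem_branch hR hT hwR hwT h hv ▸ hzR)
  -- the branch at `w` containing `z` avoids `v`
  refine branch_subset (fun a haR haw => ?_) (fun a ha ha' b hab hb => ?_) hzR
  · by_contra haS
    obtain ⟨c, hcR, d, hdR, hcd, hc, hd⟩ := hΓ.exists_adj_crossing hR hwR haR hw haS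
    have hdv : d = v := by
      by_contra hdv
      exact hd (mem_branch_of_adj hc hcd hdv)
    subst hdv
    exact hvR (mem_branch_of_mem hdR (ne_of_mem_branch hw).symm)
  · refine mem_branch_of_adj ha' hab ?_
    rintro rfl
    exact hvR (mem_branch_of_adj ha hab hb)

end IsFactorFamily

/-- The half-spaces of the free product: the branches and their complements. -/
def halfSpaces (Γ : ∀ i, SimpleGraph (V i)) (u : ∀ i, V i) : Set (Set (Vertex u)) :=
  {H | ∃ v, ∃ S ∈ sheets u, v ∈ S ∧ (H = branch Γ v S ∨ H = (branch Γ v S)ᶜ)}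

theorem branch_mem_halfSpaces {v : Vertex u} {S : Set (Vertex u)} (hS : S ∈ sheets u)
    (hv : v ∈ S) : branch Γ v S ∈ halfSpaces Γ u := ⟨v, S, hS, hv, Or.inl rfl⟩

theorem compl_mem_halfSpaces {H : Set (Vertex u)} (hH : H ∈ halfSpaces Γ u) :
    Hᶜ ∈ halfSpaces Γ u := by
  obtain ⟨v, S, hS, hv, rfl | rfl⟩ := hH
  · exact ⟨v, S, hS, hv, Or.inr rfl⟩
  · exact ⟨v, S, hS, hv, Or.inl (compl_compl _)⟩

theorem smul_mem_halfSpaces {g : Aut Γ u} (hg : g ∈ autS Γ u) {H : Set (Vertex u)}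
    (hH : H ∈ halfSpaces Γ u) : g • H ∈ halfSpaces Γ u := by
  obtain ⟨v, S, hS, hv, rfl | rfl⟩ := hH
  · exact ⟨g • v, g • S, smul_mem_sheets hg hS, Set.smul_mem_smul_set hv, Or.inl (smul_branch ..)⟩
  · exact ⟨g • v, g • S, smul_mem_sheets hg hS, Set.smul_mem_smul_set hv,
      Or.inr (by rw [Set.smul_set_compl, smul_branch])⟩

namespace IsFactorFamily

variable (hΓ : IsFactorFamily Γ)
include hΓ

theorem nonempty_halfSpace {H : Set (Vertex u)} (hH : H ∈ halfSpaces Γ u) : H.Nonempty := by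
  obtain ⟨v, S, hS, hv, rfl | rfl⟩ := hH
  · obtain ⟨w, hw, hwv⟩ := hΓ.exists_mem_sheet_ne hS hv
    exact ⟨w, mem_branch_of_mem hw hwv⟩
  · exact ⟨v, notMem_branch v S⟩

theorem nested_branches {v w : Vertex u} {S T : Set (Vertex u)} (hS : S ∈ sheets u) (hvS : v ∈ S)
    (hT : T ∈ sheets u) (hwT : w ∈ T) :
    branch Γ v S ⊆ branch Γ w T ∨ branch Γ v S ⊆ (branch Γ w T)ᶜ ∨
      (branch Γ v S)ᶜ ⊆ branch Γ w T ∨ (branch Γ v S)ᶜ ⊆ (branch Γ w T)ᶜ := by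
  have disj : ∀ {x : Vertex u} {A B : Set (Vertex u)}, A ∈ sheets u → x ∈ A → B ∈ sheets u →
      x ∈ B → A ≠ B → branch Γ x A ⊆ (branch Γ x B)ᶜ :=
    fun hA hxA hB hxB hAB z hzA hzB => hAB (hΓ.eq_of_mem_branch hA hB hxA hxB hzA hzB)
  by_cases hvw : v = w
  · subst hvw
    by_cases hST : S = T
    · exact Or.inl (hST ▸ Set.Subset.rfl)
    · exact Or.inr (Or.inl (disj hS hvS hT hwT hST))
  obtain ⟨S', hS', hvS', hw⟩ := hΓ.exists_mem_branch (Ne.symm hvw)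
  obtain ⟨T', hT', hwT', hv⟩ := hΓ.exists_mem_branch hvw
  have h1 : (branch Γ w T')ᶜ ⊆ branch Γ v S' := hΓ.compl_branch_subset hT' hwT' hw hv
  have h2 : (branch Γ v S')ᶜ ⊆ branch Γ w T' := Set.compl_subset_comm.1 h1
  by_cases hSS : S = S' <;> by_cases hTT : T = T'
  · subst hSS hTT
    exact Or.inr (Or.inr (Or.inl h2))
  · subst hSS
    refine Or.inr (Or.inr (Or.inr (Set.compl_subset_compl.2 ?_)))
    exact (disj hT hwT hT' hwT' hTT).trans h1
  · subst hTT
    exact Or.inl ((disj hS hvS hS' hvS' hSS).trans h2)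
  · refine Or.inr (Or.inl ?_)
    exact ((disj hS hvS hS' hvS' hSS).trans h2).trans
      (Set.subset_compl_comm.1 (disj hT hwT hT' hwT' hTT))

theorem nested_halfSpaces {H K : Set (Vertex u)} (hH : H ∈ halfSpaces Γ u)
    (hK : K ∈ halfSpaces Γ u) : H ⊆ K ∨ H ⊆ Kᶜ ∨ Hᶜ ⊆ K ∨ Hᶜ ⊆ Kᶜ := by
  obtain ⟨v, S, hS, hvS, hH⟩ := hH
  obtain ⟨w, T, hT, hwT, hK⟩ := hK
  have := hΓ.nested_branches hS hvS hT hwT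
  rcases hH with rfl | rfl <;> rcases hK with rfl | rfl <;> try simp only [compl_compl]
  all_goals tauto

/-- An edge in the sheet `S` is separated only by the branches through `S` at its end points. -/
theorem finite_separating_adj {p q : Vertex u} (hpq : (freeProduct Γ u).Adj p q) :
    {H | H ∈ halfSpaces Γ u ∧ p ∈ H ∧ q ∉ H}.Finite := by
  obtain ⟨R, hR, hpR, hqR⟩ := exists_sheet_of_adj hpq
  refine (Set.toFinite {branch Γ q R, (branch Γ p R)ᶜ}).subset ?_
  have key : ∀ {v a b : Vertex u} {S : Set (Vertex u)}, S ∈ sheets u → v ∈ S → a ∈ R → b ∈ R →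
      (freeProduct Γ u).Adj a b → a ∈ branch Γ v S → b ∉ branch Γ v S →
      branch Γ v S = branch Γ b R := by
    intro v a b S hS hv haR hbR hab ha hb
    obtain rfl : R = S := hΓ.eq_of_crossing hS hv hR haR hbR ha hb
    obtain rfl : b = v := by
      by_contra hbv
      exact hb (mem_branch_of_adj ha hab hbv)
    rfl
  rintro _ ⟨⟨v, S, hS, hv, rfl | rfl⟩, hp, hq⟩
  · exact Or.inl (key hS hv hpR hqR hpq hp hq)
  · exact Or.inr (congrArg _ (key hS hv hqR hpR hpq.symm (not_not.1 hq) hp))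

theorem finite_separating (p q : Vertex u) :
    {H | H ∈ halfSpaces Γ u ∧ p ∈ H ∧ q ∉ H}.Finite := by
  have := hΓ.eq_univ_of_adj_closed
    (D := {q | {H | H ∈ halfSpaces Γ u ∧ p ∈ H ∧ q ∉ H}.Finite}) ⟨p, ?_⟩ ?_
  · exact Set.eq_univ_iff_forall.1 this q
  · exact Set.finite_empty.subset fun H hH => hH.2.2 hH.2.1
  · intro a ha b hab
    refine (ha.union (hΓ.finite_separating_adj hab)).subset fun H hH => ?_
    by_cases haH : a ∈ H
    · exact Or.inr ⟨hH.1, haH, hH.2.2⟩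
    · exact Or.inl ⟨hH.1, hH.2.1, haH⟩

/-- Any half-space can be moved into any other one by a sheet-preserving automorphism: the
complement of a branch of type `i` embeds in a branch of type `i` at another vertex of the sheet,
and a branch of type `i` lies in the complement of the branch of type `j ≠ i` at the same vertex. -/
theorem exists_smul_subset_halfSpace {H K : Set (Vertex u)} (hH : H ∈ halfSpaces Γ u)
    (hK : K ∈ halfSpaces Γ u) : ∃ g ∈ autS Γ u, g • H ⊆ K := by
  -- `M H K` states that `H` can be moved into `K`; by transitivity, for branches and complements of
  -- branches this only depends on the types of the sheets
  let M : Set (Vertex u) → Set (Vertex u) → Prop := fun H K => ∃ g ∈ autS Γ u, g • H ⊆ K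
  have trans : ∀ {H K L}, M H K → M K L → M H L := by
    rintro H K L ⟨g, hg, h⟩ ⟨g', hg', h'⟩
    refine ⟨g' * g, Subgroup.mul_mem _ hg' hg, ?_⟩
    rw [mul_smul]
    exact (Set.smul_set_mono h).trans h'
  have move : ∀ v w i, M (branch Γ v (sheet v i)) (branch Γ w (sheet w i)) := by
    intro v w i
    obtain ⟨g, hg, hgv, hgS⟩ := hΓ.exists_autS_smul_sheet v w
    exact ⟨g, hg, by rw [smul_branch, hgv, hgS]⟩
  have move' : ∀ v w i, M (branch Γ v (sheet v i))ᶜ (branch Γ w (sheet w i))ᶜ := by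
    intro v w i
    obtain ⟨g, hg, hgv, hgS⟩ := hΓ.exists_autS_smul_sheet v w
    exact ⟨g, hg, by rw [Set.smul_set_compl, smul_branch, hgv, hgS]⟩
  have ofSubset : ∀ {H K : Set (Vertex u)}, H ⊆ K → M H K := fun h =>
    ⟨1, Subgroup.one_mem _, by rwa [one_smul]⟩
  have step1 : ∀ v w i, M (branch Γ v (sheet v i))ᶜ (branch Γ w (sheet w i)) := by
    intro v w i
    obtain ⟨z, hz, hzw⟩ := hΓ.exists_mem_sheet_ne (sheet_mem_sheets w i) (self_mem_sheet w i)
    refine trans (move' v z i) (ofSubset ?_)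
    refine hΓ.compl_branch_subset (sheet_mem_sheets z i) (self_mem_sheet z i)
      (mem_branch_of_mem hz hzw) ?_
    rw [sheet_eq_of_mem hz]
    exact mem_branch_of_mem (self_mem_sheet w i) hzw.symm
  have step2 : ∀ v w i j, i ≠ j → M (branch Γ v (sheet v i)) (branch Γ w (sheet w j))ᶜ := by
    intro v w i j hij
    refine trans (move v w i) (ofSubset fun z hz hz' => hij ?_)
    have h := hΓ.eq_of_mem_branch (sheet_mem_sheets w i) (sheet_mem_sheets w j)
      (self_mem_sheet w i) (self_mem_sheet w j) hz hz'
    have := hΓ.nontrivial i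
    obtain ⟨x, hx⟩ := exists_ne (update u w.1 i)
    have hm := move_mem_sheet w i x
    rw [h] at hm
    obtain ⟨y, hy⟩ := mem_sheet_iff.1 hm
    by_contra hij
    have e := congrArg (fun z => update u z.1 i) hy
    simp [update_move, hij] at e
    exact hx e
  have : Nontrivial (Fin n) := Fin.nontrivial_iff_two_le.2 hΓ.two_le
  have bb : ∀ v w i j, M (branch Γ v (sheet v i)) (branch Γ w (sheet w j)) := by
    intro v w i j
    by_cases hij : i = j
    · subst hij; exact move v w i
    · exact trans (step2 v w i j hij) (step1 w w j)
  have bc : ∀ v w i j, M (branch Γ v (sheet v i)) (branch Γ w (sheet w j))ᶜ := by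
    intro v w i j
    obtain ⟨k, hk⟩ := exists_ne j
    exact trans (bb v w i k) (step2 w w k j hk)
  obtain ⟨v, S, hS, hv, hH⟩ := hH
  obtain ⟨w, T, hT, hw, hK⟩ := hK
  obtain ⟨i, rfl⟩ := exists_eq_sheet hS hv
  obtain ⟨j, rfl⟩ := exists_eq_sheet hT hw
  change M H K
  rcases hH with rfl | rfl <;> rcases hK with rfl | rfl
  · exact bb v w i j
  · exact bc v w i j
  · exact trans (step1 v v i) (bb v w i j)
  · exact trans (step1 v v i) (bc v w i j)

end IsFactorFamily

end Branches

end GraphFreeProduct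

/-! ### Independence and simplicity -/

namespace GraphFreeProduct

universe w

open scoped Pointwise

section Independence

variable {n : ℕ} {V : Fin n → Type w} {Γ : ∀ i, SimpleGraph (V i)} {u : ∀ i, V i}

/-- Permutations that agree on each sheet with a sheet-preserving automorphism, and whose inverses
do so too, are sheet-preserving automorphisms. -/
theorem exists_autS_of_local (f : Equiv.Perm (Vertex u))
    (hf : ∀ S ∈ sheets u, ∃ g ∈ autS Γ u, ∀ z ∈ S, f z = g • z)
    (hf' : ∀ S ∈ sheets u, ∃ g ∈ autS Γ u, ∀ z ∈ S, f.symm z = g • z) :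
    ∃ F ∈ autS Γ u, ∀ z, F • z = f z := by
  have adj : ∀ f : Equiv.Perm (Vertex u),
      (∀ S ∈ sheets u, ∃ g ∈ autS Γ u, ∀ z ∈ S, f z = g • z) → ∀ a b,
      (freeProduct Γ u).Adj a b → (freeProduct Γ u).Adj (f a) (f b) := by
    intro f hf a b hab
    obtain ⟨S, hS, ha, hb⟩ := exists_sheet_of_adj hab
    obtain ⟨g, -, hg⟩ := hf S hS
    rw [hg a ha, hg b hb]
    exact g.map_rel_iff.2 hab
  have maps : ∀ f : Equiv.Perm (Vertex u),
      (∀ S ∈ sheets u, ∃ g ∈ autS Γ u, ∀ z ∈ S, f z = g • z) → ∀ S ∈ sheets u,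
      (fun z => f z) '' S ∈ sheets u := by
    intro f hf S hS
    obtain ⟨g, hg, hgS⟩ := hf S hS
    rw [Set.image_congr hgS]
    exact smul_mem_sheets hg hS
  refine ⟨⟨f, fun {a b} => ⟨fun h => ?_, adj f hf a b⟩⟩, ⟨maps f hf, maps f.symm hf'⟩, fun z => rfl⟩
  simpa using adj f.symm hf' _ _ h

/-- `g` acts on the half-space `H` and can be extended by the identity outside `H`: it stabilises
the flag `(v, S)` defining `H`, and fixes all points of `S` if `H` meets `S` in `v` only. -/
def IsCuttable (Γ : ∀ i, SimpleGraph (V i)) (g : Aut Γ u) (H : Set (Vertex u)) : Prop :=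
  g ∈ autS Γ u ∧ ∃ v, ∃ S ∈ sheets u, v ∈ S ∧ g • v = v ∧ g • S = S ∧
    (H = branch Γ v S ∨ H = (branch Γ v S)ᶜ ∧ ∀ z ∈ S, g • z = z)

theorem IsCuttable.inv {g : Aut Γ u} {H : Set (Vertex u)} (h : IsCuttable Γ g H) :
    IsCuttable Γ g⁻¹ H := by
  obtain ⟨hg, v, S, hS, hv, hgv, hgS, h⟩ := h
  refine ⟨Subgroup.inv_mem _ hg, v, S, hS, hv, inv_smul_eq_iff.2 hgv.symm,
    inv_smul_eq_iff.2 hgS.symm, h.imp_right fun h => ⟨h.1, fun z hz => ?_⟩⟩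
  exact inv_smul_eq_iff.2 (h.2 z hz).symm

theorem IsCuttable.smul_eq {g : Aut Γ u} {H : Set (Vertex u)} (h : IsCuttable Γ g H) :
    g • H = H := by
  obtain ⟨-, v, S, -, -, hgv, hgS, h⟩ := h
  rcases h with rfl | ⟨rfl, -⟩
  · rw [smul_branch, hgv, hgS]
  · rw [Set.smul_set_compl, smul_branch, hgv, hgS]

section Glue

variable {ι : Type*} {H : ι → Set (Vertex u)} {f : ι → Aut Γ u}

open Classical in
/-- The map that acts as `f k` on `H k` and as the identity outside all `H k`. -/
noncomputable def glueFun (H : ι → Set (Vertex u)) (f : ι → Aut Γ u) (z : Vertex u) : Vertex u :=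
  if h : ∃ k, z ∈ H k then f h.choose • z else z

theorem glueFun_of_mem (hd : Pairwise fun k l => Disjoint (H k) (H l)) {k : ι} {z : Vertex u}
    (hz : z ∈ H k) : glueFun H f z = f k • z := by
  have h : ∃ k, z ∈ H k := ⟨k, hz⟩
  have : h.choose = k := by
    by_contra hne
    exact Set.disjoint_left.1 (hd hne) h.choose_spec hz
  rw [glueFun, dif_pos h, this]

theorem glueFun_of_notMem {z : Vertex u} (hz : ∀ k, z ∉ H k) : glueFun H f z = z :=
  dif_neg (by simpa using hz)

theorem glueFun_inv_glueFun (hd : Pairwise fun k l => Disjoint (H k) (H l))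
    (hf : ∀ k, IsCuttable Γ (f k) (H k)) (z : Vertex u) :
    glueFun H (fun k => (f k)⁻¹) (glueFun H f z) = z := by
  by_cases hz : ∃ k, z ∈ H k
  · obtain ⟨k, hk⟩ := hz
    have : f k • z ∈ H k := by
      rw [← (hf k).smul_eq]
      exact Set.smul_mem_smul_set hk
    rw [glueFun_of_mem hd hk, glueFun_of_mem hd this, inv_smul_smul]
  · push Not at hz
    rw [glueFun_of_notMem hz, glueFun_of_notMem hz]

theorem IsFactorFamily.glueFun_local (hΓ : IsFactorFamily Γ)
    (hd : Pairwise fun k l => Disjoint (H k) (H l))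
    (hf : ∀ k, IsCuttable Γ (f k) (H k)) {T : Set (Vertex u)} (hT : T ∈ sheets u) :
    ∃ g ∈ autS Γ u, ∀ z ∈ T, glueFun H f z = g • z := by
  by_cases hsub : ∃ k, T ⊆ H k
  · obtain ⟨k, hk⟩ := hsub
    exact ⟨f k, (hf k).1, fun z hz => glueFun_of_mem hd (hk hz)⟩
  push Not at hsub
  -- a half-space that meets `T` has its defining flag in `T`
  have cross : ∀ k, (T ∩ H k).Nonempty → ∃ v ∈ T, f k • v = v ∧ f k • T = T ∧
      (H k = branch Γ v T ∨ ∀ z ∈ T, f k • z = z) := by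
    rintro k ⟨p, hpT, hp⟩
    obtain ⟨q, hqT, hq⟩ := Set.not_subset.1 (hsub k)
    obtain ⟨-, v, S, hS, hvS, hfv, hfS, h⟩ := hf k
    have hTS : T = S := by
      rcases h with h | ⟨h, -⟩
      · rw [h] at hp hq
        exact hΓ.eq_of_crossing hS hvS hT hpT hqT hp hq
      · rw [h] at hp hq
        exact hΓ.eq_of_crossing hS hvS hT hqT hpT (not_not.1 hq) hp
    subst hTS
    exact ⟨v, hvS, hfv, hfS, h.imp_right And.right⟩
  by_cases hex : ∃ k, ∃ v ∈ T, H k = branch Γ v T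
  · obtain ⟨k, v, hvT, hk⟩ := hex
    have hTk : ∀ z ∈ T, z ≠ v → z ∈ H k := fun z hz hzv => hk ▸ mem_branch_of_mem hz hzv
    obtain ⟨w, hwT, hwv⟩ := hΓ.exists_mem_sheet_ne hT hvT
    refine ⟨f k, (hf k).1, fun z hz => ?_⟩
    by_cases hzv : z = v
    · subst hzv
      have hkz : f k • z = z := by
        obtain ⟨v', hv', hfv', hfT, h⟩ := cross k ⟨w, hwT, hTk w hwT hwv⟩
        rcases h with h | h
        · by_cases e : z = v'
          · rw [e, hfv']
          · exact absurd (h ▸ mem_branch_of_mem hz e : z ∈ H k) (hk ▸ notMem_branch z T)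
        · exact h z hz
      rw [hkz]
      by_cases hl : ∃ l, z ∈ H l
      · -- then `H l` meets `T` in `z` only, so that `f l` fixes `z`
        obtain ⟨l, hl⟩ := hl
        rw [glueFun_of_mem hd hl]
        have hlk : l ≠ k := by
          rintro rfl
          exact notMem_branch z T (hk ▸ hl)
        obtain ⟨v', -, -, hfT, -⟩ := cross l ⟨z, hz, hl⟩
        by_contra hne
        have h1 : f l • z ∈ T := by
          rw [← hfT]; exact Set.smul_mem_smul_set hz
        have h2 : f l • z ∈ H l := by
          rw [← (hf l).smul_eq]; exact Set.smul_mem_smul_set hl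
        exact Set.disjoint_left.1 (hd hlk) h2 (hTk _ h1 hne)
      · exact glueFun_of_notMem (by simpa using hl)
    · exact glueFun_of_mem hd (hTk z hz hzv)
  · refine ⟨1, Subgroup.one_mem _, fun z hz => ?_⟩
    rw [one_smul]
    by_cases hk : ∃ k, z ∈ H k
    · obtain ⟨k, hk⟩ := hk
      rw [glueFun_of_mem hd hk]
      obtain ⟨v, hv, -, -, h⟩ := cross k ⟨z, hz, hk⟩
      rcases h with h | h
      · exact absurd ⟨k, v, hv, h⟩ hex
      · exact h z hz
    · exact glueFun_of_notMem (by simpa using hk)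

/-- Cuttable automorphisms of disjoint half-spaces can be performed simultaneously. -/
theorem IsFactorFamily.exists_glue (hΓ : IsFactorFamily Γ)
    (hd : Pairwise fun k l => Disjoint (H k) (H l)) (hf : ∀ k, IsCuttable Γ (f k) (H k)) :
    ∃ F ∈ autS Γ u, (∀ k, ∀ z ∈ H k, F • z = f k • z) ∧ ∀ z, (∀ k, z ∉ H k) → F • z = z := by
  have hf' := fun k => (hf k).inv
  let e : Equiv.Perm (Vertex u) :=
    { toFun := glueFun H f
      invFun := glueFun H fun k => (f k)⁻¹
      left_inv := glueFun_inv_glueFun hd hf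
      right_inv := fun z => by simpa using glueFun_inv_glueFun hd hf' z }
  obtain ⟨F, hF, hFe⟩ := exists_autS_of_local e (fun S hS => hΓ.glueFun_local hd hf hS)
    (fun S hS => hΓ.glueFun_local hd hf' hS)
  exact ⟨F, hF, fun k z hz => (hFe z).trans (glueFun_of_mem hd hz),
    fun z hz => (hFe z).trans (glueFun_of_notMem hz)⟩

end Glue

open HalfSpace

namespace IsFactorFamily

variable (hΓ : IsFactorFamily Γ)
include hΓ

theorem isCuttable_of_mem_rist {H : Set (Vertex u)} (hH : H ∈ halfSpaces Γ u) {f : Aut Γ u}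
    (hf : f ∈ rist (autS Γ u) H) : IsCuttable Γ f H := by
  have hfH := smul_eq_of_mem_rist hf
  have hfG := (mem_rist.1 hf).1
  have hfix := (mem_rist.1 hf).2
  have hmaps : ∀ z ∈ H, f • z ∈ H := fun z hz => by
    rw [← hfH]; exact Set.smul_mem_smul_set hz
  obtain ⟨v, S, hS, hv, h⟩ := hH
  obtain ⟨w, hw, hwv⟩ := hΓ.exists_mem_sheet_ne hS hv
  have hwb : w ∈ branch Γ v S := mem_branch_of_mem hw hwv
  refine ⟨hfG, v, S, hS, hv, ?_⟩
  rcases h with rfl | rfl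
  · have hfv : f • v = v := hfix v (notMem_branch v S)
    refine ⟨hfv, ?_, Or.inl rfl⟩
    refine hΓ.eq_of_crossing hS hv (smul_mem_sheets hfG hS) (Set.smul_mem_smul_set hw)
      (Set.smul_mem_smul_set hv) (hmaps w hwb) ?_
    rw [hfv]
    exact notMem_branch v S
  · have hfw : f • w = w := hfix w fun h => h hwb
    have hfv : f • v ∉ branch Γ v S := hmaps v (notMem_branch v S)
    have hfS : f • S = S := by
      refine hΓ.eq_of_crossing hS hv (smul_mem_sheets hfG hS) (Set.smul_mem_smul_set hw)
        (Set.smul_mem_smul_set hv) ?_ hfv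
      rwa [hfw]
    have hfv' : f • v = v := by
      by_contra hne
      exact hfv (mem_branch_of_mem (hfS ▸ Set.smul_mem_smul_set hv) hne)
    refine ⟨hfv', hfS, Or.inr ⟨rfl, fun z hz => ?_⟩⟩
    by_cases hzv : z = v
    · rw [hzv, hfv']
    · exact hfix z fun h => h (mem_branch_of_mem hz hzv)

theorem isSystem : IsSystem (autS Γ u) (halfSpaces Γ u) where
  compl_mem := compl_mem_halfSpaces
  nonempty := hΓ.nonempty_halfSpace
  smul_mem hg hH := smul_mem_halfSpaces hg hH
  nested := nested_halfSpaces hΓ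
  finite_separating := hΓ.finite_separating
  exists_separating h := by
    obtain ⟨S, hS, hq, hp⟩ := hΓ.exists_mem_branch h
    exact ⟨_, branch_mem_halfSpaces hS hq, hp, notMem_branch _ S⟩
  exists_smul_subset := hΓ.exists_smul_subset_halfSpace
  glue _ _ hH hd hf := hΓ.exists_glue hd fun k =>
    hΓ.isCuttable_of_mem_rist (hH k) (mem_rist.2 (hf k))

/-- A stabiliser of a flag is the product of the rigid stabilisers of the two half-spaces it
defines. -/
theorem plusS_eq_plus : plusS (autS Γ u) = plus (autS Γ u) (halfSpaces Γ u) := by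
  apply le_antisymm
  · refine (Subgroup.closure_le _).2
      (Set.iUnion₂_subset fun S hS => Set.iUnion₂_subset fun v hv => ?_)
    rintro g ⟨hg, hgv, hgS⟩
    have hcut : IsCuttable Γ g (branch Γ v S) := ⟨hg, v, S, hS, hv, hgv, hgS, Or.inl rfl⟩
    obtain ⟨a, ha, ha1, ha2⟩ := hΓ.exists_glue (ι := Unit) (H := fun _ => branch Γ v S)
      (f := fun _ => g) (fun k l h => absurd rfl h) fun _ => hcut
    have h1 : a ∈ plus (autS Γ u) (halfSpaces Γ u) :=
      rist_le_plus _ (branch_mem_halfSpaces hS hv) (mem_rist.2 ⟨ha, fun z hz => ha2 z fun _ => hz⟩)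
    have h2 : a⁻¹ * g ∈ plus (autS Γ u) (halfSpaces Γ u) := by
      refine rist_le_plus _ (compl_mem_halfSpaces (branch_mem_halfSpaces hS hv)) (mem_rist.2
        ⟨Subgroup.mul_mem _ (Subgroup.inv_mem _ ha) hg, fun z hz => ?_⟩)
      rw [mul_smul, inv_smul_eq_iff, ha1 () z (not_not.1 hz)]
    simpa using Subgroup.mul_mem _ h1 h2
  · refine iSup₂_le fun H hH f hf => Subgroup.subset_closure ?_
    obtain ⟨hfG, v, S, hS, hv, hfv, hfS, -⟩ := hΓ.isCuttable_of_mem_rist hH hf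
    exact Set.mem_biUnion hS (Set.mem_biUnion hv ⟨hfG, hfv, hfS⟩)

end IsFactorFamily

end Independence

end GraphFreeProduct

theorem mainTheorem4 {n : ℕ} (hn : 2 ≤ n) {V : Fin n → Type*}
    (Γ : ∀ i, SimpleGraph (V i)) (hnt : ∀ i, Nontrivial (V i))
    (hconn : ∀ i, (Γ i).Connected)
    (htrans : ∀ i, GraphFreeProduct.IsVertexTransitive (Γ i)) (u : ∀ i, V i) :
    GraphFreeProduct.plusS (GraphFreeProduct.autS Γ u) = ⊥ ∨
      IsSimpleGroup (GraphFreeProduct.plusS (GraphFreeProduct.autS Γ u)) := by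
  have hΓ : GraphFreeProduct.IsFactorFamily Γ := ⟨hn, hnt, hconn, htrans⟩
  rw [hΓ.plusS_eq_plus]
  set P := HalfSpace.plus (GraphFreeProduct.autS Γ u) (GraphFreeProduct.halfSpaces Γ u)
  refine or_iff_not_imp_left.2 fun hP => ?_
  have : Nontrivial P := P.nontrivial_iff_ne_bot.2 hP
  refine ⟨fun N hN => or_iff_not_imp_left.2 fun hN1 => ?_⟩
  have h : P ≤ N.map P.subtype := by
    refine hΓ.isSystem.plus_le_of_normalized (Subgroup.map_subtype_le N) ?_ ?_
    · rwa [Ne, Subgroup.map_eq_bot_iff_of_injective _ P.subtype_injective]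
    · rintro g hg _ ⟨x, hx, rfl⟩
      exact ⟨⟨g, hg⟩ * x * ⟨g, hg⟩⁻¹, hN.conj_mem x hx _, rfl⟩
  refine eq_top_iff.2 fun x _ => ?_
  obtain ⟨y, hy, hyx⟩ := h x.2
  rwa [← P.subtype_injective hyx]
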